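/- Let $k,\ell,m\ge 1$ be integers with $\ell\le m$, let $B^m\subset\mathbb{R}^m$ be the open unit ball, and write $r=\|x\|$, $y_i=x_i/r$. For $x\in\mathbb{R}^m\setminus\{0\}$ and $1\le i_1,\dots,i_\ell\le m$ define recursively $u^{(1)}_{i_1}(x)=y_{i_1}$ and, for $\ell\ge 2$, $$u^{(\ell)}_{i_1\dots i_\ell}(x)=C_{\ell,m}\Big(y_{i_\ell}\,u^{(\ell-1)}_{i_1\dots i_{\ell-1}}(x)-\frac{1}{\ell+m-3}\,r\,\frac{\partial}{\partial x_{i_\ell}}u^{(\ell-1)}_{i_1\dots i_{\ell-1}}(x)\Big),\qquad C_{\ell,m}=\sqrt{\frac{\ell+m-3}{2\ell+m-4}}.$$ The generalized equator map is $u_\star^{(\ell)}(x)=(u^{(\ell)}(x),0)\in\mathbb{R}^{m^\ell}\times\mathbb{R}$. For $n\ge 1$ let $W^{k,2}(B^m,\mathbb{S}^{n})$ be the set of $u\in W^{k,2}(B^m,\mathbb{R}^{n+1})$ with $|u(x)|=1$ for almost every $x\in B^m$, and for such $u$ let $$E_k(u)=\tfrac12\int_{B^m}|\Delta^{s}u|^2\,dx\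 \text{ if }k=2s,\qquad E_k(u)=\tfrac12\int_{B^m}|\nabla\Delta^{s}u|^2\,dx\ \text{ if }k=2s+1 .$$ A map $u\in W^{k,2}(B^m,\mathbb{S}^n)$ is called extrinsic $k$-harmonic if it is a critical point of $E_k$, that is, $\frac{d}{dt}\big|_{t=0}E_k(u_t)$ exists and equals $0$ for every family $(u_t)_{|t|<\varepsilon}$ in $W^{k,2}(B^m,\mathbb{S}^n)$ with $u_0=u$ and $u_t-u\in W^{k,2}_0(B^m,\mathbb{R}^{n+1})$ that is differentiable at $t=0$ as a curve in $W^{k,2}(B^m,\mathbb{R}^{n+1})$. Theorem. The map $u_\star^{(\ell)}$ belongs to $W^{k,2}(B^m,\mathbb{S}^{m^\ell})$ if and only if $m\ge 2k+1$. If $m\ge 2k+1$, then $u_\star^{(\ell)}$ is an extrinsic $k$-harmonic map. -/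

import Mathlib

open Set Filter Topology MeasureTheory
open scoped ContDiff

noncomputable section

namespace ExtrinsicHarmonic

/-! ### Sobolev spaces of vector-valued functions through weak derivatives -/

section Sobolev

variable {m : ℕ} {F : Type*} [NormedAddCommGroup F] [InnerProductSpace ℝ F]

/-- Smooth functions with compact support contained in `Ω`. -/
def IsTestFunction {G : Type*} [NormedAddCommGroup G] [NormedSpace ℝ G]
    (Ω : Set (EuclideanSpace ℝ (Fin m))) (φ : EuclideanSpace ℝ (Fin m) → G) : Prop :=
  ContDiff ℝ ∞ φ ∧ HasCompactSupport φ ∧ tsupport φ ⊆ Ω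

/-- `g` is a weak partial derivative `∂u/∂xᵢ` of `u` on the open set `Ω`. -/
def HasWeakPartial (Ω : Set (EuclideanSpace ℝ (Fin m))) (i : Fin m)
    (u g : EuclideanSpace ℝ (Fin m) → F) : Prop :=
  LocallyIntegrableOn u Ω ∧ LocallyIntegrableOn g Ω ∧
    ∀ φ : EuclideanSpace ℝ (Fin m) → ℝ, IsTestFunction Ω φ →
      ∫ x in Ω, (fderiv ℝ φ x (EuclideanSpace.single i 1)) • u x = -∫ x in Ω, φ x • g x

/-- The space `W^{k,2}(Ω, F)`: all weak derivatives of order at most `k` exist and are in `L²`. -/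
def MemW (Ω : Set (EuclideanSpace ℝ (Fin m))) : ℕ → (EuclideanSpace ℝ (Fin m) → F) → Prop
  | 0, u => MemLp u 2 (volume.restrict Ω)
  | k + 1, u => MemLp u 2 (volume.restrict Ω) ∧
      ∀ i : Fin m, ∃ g : EuclideanSpace ℝ (Fin m) → F, HasWeakPartial Ω i u g ∧ MemW Ω k g

open Classical in
/-- The weak partial derivative `∂u/∂xᵢ`, which is unique up to equality almost everywhere
(and the value `0` if there is none). -/
def weakPartial (Ω : Set (EuclideanSpace ℝ (Fin m))) (i : Fin m)
    (u : EuclideanSpace ℝ (Fin m) → F) : EuclideanSpace ℝ (Fin m) → F :=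
  if h : ∃ g, HasWeakPartial Ω i u g then h.choose else 0

/-- A norm of `W^{k,2}(Ω, F)`: the sum of the `L²` norms of all iterated weak partial derivatives
of order at most `k`. To be used on elements of `W^{k,2}(Ω, F)` only. -/
def sobolevNorm (Ω : Set (EuclideanSpace ℝ (Fin m))) :
    ℕ → (EuclideanSpace ℝ (Fin m) → F) → ENNReal
  | 0, u => eLpNorm u 2 (volume.restrict Ω)
  | k + 1, u => eLpNorm u 2 (volume.restrict Ω) +
      ∑ i : Fin m, sobolevNorm Ω k (weakPartial Ω i u)

/-- The space `W_0^{k,2}(Ω, F)`: the closure of the test functions in `W^{k,2}(Ω, F)`. -/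
def MemWZero (Ω : Set (EuclideanSpace ℝ (Fin m))) (k : ℕ)
    (v : EuclideanSpace ℝ (Fin m) → F) : Prop :=
  MemW Ω k v ∧ ∀ ε : ENNReal, 0 < ε → ∃ φ : EuclideanSpace ℝ (Fin m) → F,
    IsTestFunction Ω φ ∧ sobolevNorm Ω k (v - φ) < ε

/-- `W^{k,2}(Ω, S)`, where `S` is the unit sphere of the Euclidean space `F`. -/
def MemWSphere (Ω : Set (EuclideanSpace ℝ (Fin m))) (k : ℕ)
    (u : EuclideanSpace ℝ (Fin m) → F) : Prop :=
  MemW Ω k u ∧ ∀ᵐ x ∂(volume.restrict Ω), u x ∈ Metric.sphere (0 : F) 1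

/-! ### The extrinsic energies and their critical points -/

/-- The Laplacian `Δu = ∑ᵢ ∂ᵢ∂ᵢu` in the weak sense. -/
def weakLaplacian (Ω : Set (EuclideanSpace ℝ (Fin m)))
    (u : EuclideanSpace ℝ (Fin m) → F) : EuclideanSpace ℝ (Fin m) → F :=
  fun x => ∑ i : Fin m, weakPartial Ω i (weakPartial Ω i u) x

/-- The extrinsic `k`-energy of `u ∈ W^{k,2}(Ω, F)`: `½ ∫ |Δˢu|²` if `k = 2s`, and
`½ ∫ |∇Δˢu|²` if `k = 2s + 1`. -/
def extrinsicEnergy (Ω : Set (EuclideanSpace ℝ (Fin m))) (k : ℕ)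
    (u : EuclideanSpace ℝ (Fin m) → F) : ℝ :=
  if Even k then
    (1 / 2) * ∫ x in Ω, ‖((weakLaplacian Ω)^[k / 2] u) x‖ ^ 2
  else
    (1 / 2) * ∫ x in Ω, ∑ i : Fin m, ‖weakPartial Ω i ((weakLaplacian Ω)^[k / 2] u) x‖ ^ 2

/-- A variation of `u` in `W^{k,2}(Ω, S)`: a family `U t` of maps in `W^{k,2}(Ω, S)`, for `t` near
`0`, with `U 0 = u` and `U t - u ∈ W_0^{k,2}(Ω, F)`, which is differentiable at `t = 0` as a curve
in `W^{k,2}(Ω, F)`. -/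
def IsVariation (Ω : Set (EuclideanSpace ℝ (Fin m))) (k : ℕ)
    (u : EuclideanSpace ℝ (Fin m) → F) (U : ℝ → EuclideanSpace ℝ (Fin m) → F) : Prop :=
  U 0 =ᵐ[volume.restrict Ω] u ∧
  (∀ᶠ t in 𝓝 (0 : ℝ), MemWSphere Ω k (U t) ∧ MemWZero Ω k (U t - u)) ∧
  ∃ v : EuclideanSpace ℝ (Fin m) → F, MemW Ω k v ∧
    Tendsto (fun t : ℝ => sobolevNorm Ω k (t⁻¹ • (U t - u) - v)) (𝓝[≠] 0) (𝓝 0)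

/-- Extrinsic `k`-harmonic maps: the critical points of the extrinsic `k`-energy on
`W^{k,2}(Ω, S)`. -/
def IsExtrinsicHarmonic (Ω : Set (EuclideanSpace ℝ (Fin m))) (k : ℕ)
    (u : EuclideanSpace ℝ (Fin m) → F) : Prop :=
  MemWSphere Ω k u ∧
    ∀ U : ℝ → EuclideanSpace ℝ (Fin m) → F, IsVariation Ω k u U →
      HasDerivAt (fun t : ℝ => extrinsicEnergy Ω k (U t)) 0 0

end Sobolev

/-! ### The generalized equator map -/

/-- The constant `C_{ℓ,m}`. -/
def radialConst (ℓ m : ℕ) : ℝ :=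
  Real.sqrt (((ℓ : ℝ) + m - 3) / (2 * (ℓ : ℝ) + m - 4))

/-- The components `u^{(ℓ)}_{i₁…i_ℓ}(x)`, `ℓ ≥ 1`, of the generalized radial projection, with the
multi-index `(i₁,…,i_ℓ)` written as a function `Fin ℓ → Fin m`. The value at `ℓ = 0` is not
used. -/
def radialProj (m : ℕ) : (ℓ : ℕ) → EuclideanSpace ℝ (Fin m) → (Fin ℓ → Fin m) → ℝ
  | 0, _, _ => 1
  | 1, x, I => x (I 0) / ‖x‖
  | ℓ + 2, x, I =>
      radialConst (ℓ + 2) m *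
        (x (I (Fin.last (ℓ + 1))) / ‖x‖ * radialProj m (ℓ + 1) x (Fin.init I) -
          1 / (((ℓ + 2 : ℕ) : ℝ) + m - 3) * ‖x‖ *
            fderiv ℝ (fun z => radialProj m (ℓ + 1) z (Fin.init I)) x
              (EuclideanSpace.single (I (Fin.last (ℓ + 1))) 1))

/-- The Euclidean space `ℝ^{m^ℓ} × ℝ`, whose unit sphere is `S^{m^ℓ}`. -/
abbrev Target (m ℓ : ℕ) : Type :=
  WithLp 2 (EuclideanSpace ℝ (Fin ℓ → Fin m) × ℝ)

/-- The generalized equator map `x ↦ (u^{(ℓ)}(x), 0)`. -/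
def equatorMap (m ℓ : ℕ) (x : EuclideanSpace ℝ (Fin m)) : Target m ℓ :=
  WithLp.toLp 2 (WithLp.toLp 2 (radialProj m ℓ x), 0)

end ExtrinsicHarmonic

end

/-!
The generalized equator map `u = u_⋆^{(ℓ)}` is smooth and homogeneous of degree `0` off the
origin. The recursion defining it says that `r^{1-m-ℓ} u^{(ℓ+1)}` is a multiple of a derivative of
`r^{2-m-ℓ} u^{(ℓ)}`, so by induction `r^{2-m-ℓ} u^{(ℓ)}`, the Kelvin transform of a harmonic
polynomial of degree `ℓ`, is harmonic (`lap_norm_zpow_smul_radialProj`). Since `Δ` acts on radial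
multiples of a harmonic homogeneous function by scalars, all iterated Laplacians of `u` are radial
multiples of `u`: `Δʲu = c_j r^{-2j} u` (`exists_iterate_lap_eq`), with `c_1 = -ℓ(ℓ + m - 2)`
(`lap_equatorMap`). Together with Euler's identity for `u` the value of `c_1` also gives
`|u| = 1`, by induction on `ℓ` (`norm_equatorMap`).

*Regularity.* A derivative of order `j` of `u` is homogeneous of degree `-j`, hence square
integrable on the ball if `2j < m`, and otherwise only if it vanishes. If `m ≥ 2k + 1`, a cutoff
argument (`integral_pd_eq_zero`) shows that the classical derivatives are weak derivatives across
the origin, and `u ∈ W^{k,2}` (`MemW.of_isHomog`). If `m ≤ 2k` and `u ∈ W^{k,2}`, then the weak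
derivatives are the classical ones, so those of order `k` vanish by scaling, and Euler's identity
for the derivatives of orders `1, …, k - 1`, whose degrees are negative, forces `∇u = 0`
(`IsHomog.eq_zero_of_memW`); but `|∇u|² = ℓ(ℓ + m - 2) r⁻²` is positive for `m ≥ 2`
(`not_memW_equatorMap`). For `m = 1` the map is the sign function, which has no weak derivative
(`not_memW_equatorMap_one`).

*Criticality.* Let `m ≥ 2k + 1` and let `v` be the velocity of a variation of `u`. The energy is a
sum of squared `L²` norms of bounded linear operators on `W^{k,2}`, so its derivative along the
variation is the corresponding bilinear pairing of `u` with `v`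
(`IsSobolevOp.hasDerivAt_integral_norm_sq`). On test functions `φ`, integration by parts turns
this pairing into `±∫ ⟪Δᵏu, φ⟫ = c ∫ r^{-2k} ⟪u, φ⟫`. The velocity is an `L²` limit of difference
quotients of unit vectors, hence pointwise orthogonal to `u` (`ae_inner_velocity_eq_zero`), and it
is a limit in `W^{k,2}` of test functions. By the Hardy inequality `‖r⁻ᵏ φ‖ ≤ C ‖φ‖_{W^{k,2}}`
(`exists_hardy`), the formula `c ∫ ⟪r⁻ᵏ u, r⁻ᵏ φ⟫` passes to the limit and holds for `v`, where
the integrand vanishes (`sum_integral_inner_eq_zero`).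
-/

namespace ExtrinsicHarmonic

/-! ### Partial derivatives and functions homogeneous off the origin -/

/-- The domain `ℝᵐ` with its Euclidean norm. -/
abbrev Eucl (m : ℕ) : Type := EuclideanSpace ℝ (Fin m)

section Calculus

variable {m : ℕ} {F G H : Type*} [NormedAddCommGroup F] [NormedSpace ℝ F]
  [NormedAddCommGroup G] [NormedSpace ℝ G] [NormedAddCommGroup H] [NormedSpace ℝ H]

/-- The classical partial derivative `∂f/∂xᵢ`, which is `0` where `f` is not differentiable. -/
noncomputable def pd (i : Fin m) (f : Eucl m → F) (x : Eucl m) : F :=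
  fderiv ℝ f x (EuclideanSpace.single i 1)

/-- The classical Laplacian. It is only used off the singularities of `f`. -/
noncomputable def lap (f : Eucl m → F) (x : Eucl m) : F := ∑ i, pd i (pd i f) x

/-- `f` is smooth and homogeneous of degree `d` off the origin. The value `f 0` is arbitrary. -/
structure IsHomog (d : ℤ) (f : Eucl m → F) : Prop where
  contDiffOn : ContDiffOn ℝ ∞ f {0}ᶜ
  map_smul : ∀ t : ℝ, 0 < t → ∀ x ≠ 0, f (t • x) = t ^ d • f x

theorem compl_zero_mem_nhds {x : Eucl m} (hx : x ≠ 0) : ({0}ᶜ : Set (Eucl m)) ∈ 𝓝 x :=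
  isOpen_compl_singleton.mem_nhds hx

theorem pd_congr {i : Fin m} {f g : Eucl m → F} (h : EqOn f g {0}ᶜ) :
    EqOn (pd i f) (pd i g) {0}ᶜ := fun x hx => by
  have : f =ᶠ[𝓝 x] g := h.eventuallyEq_of_mem (compl_zero_mem_nhds hx)
  simp only [pd, this.fderiv_eq]

theorem lap_congr {f g : Eucl m → F} (h : EqOn f g {0}ᶜ) : EqOn (lap f) (lap g) {0}ᶜ :=
  fun _ hx => Finset.sum_congr rfl fun _ _ => pd_congr (pd_congr h) hx

theorem pd_add {i : Fin m} {f g : Eucl m → F} {x : Eucl m} (hf : DifferentiableAt ℝ f x)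
    (hg : DifferentiableAt ℝ g x) : pd i (fun y => f y + g y) x = pd i f x + pd i g x := by
  simp only [pd, fderiv_fun_add hf hg, add_apply]

theorem pd_const_smul {i : Fin m} (c : ℝ) (f : Eucl m → F) (x : Eucl m) :
    pd i (fun y => c • f y) x = c • pd i f x := by
  have : (fun y => c • f y) = c • f := rfl
  simp [pd, this, fderiv_const_smul_field]

theorem pd_sum {ι : Type*} {s : Finset ι} {i : Fin m} {f : ι → Eucl m → F} {x : Eucl m}
    (hf : ∀ j ∈ s, DifferentiableAt ℝ (f j) x) :
    pd i (fun y => ∑ j ∈ s, f j y) x = ∑ j ∈ s, pd i (f j) x := by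
  simp only [pd, fderiv_fun_sum hf, sum_apply]

theorem pd_bilin {i : Fin m} (B : F →L[ℝ] G →L[ℝ] H) {f : Eucl m → F} {g : Eucl m → G}
    {x : Eucl m} (hf : DifferentiableAt ℝ f x) (hg : DifferentiableAt ℝ g x) :
    pd i (fun y => B (f y) (g y)) x = B (f x) (pd i g x) + B (pd i f x) (g x) := by
  simp only [pd]
  rw [B.fderiv_of_bilinear hf hg]
  simp

theorem pd_smul {i : Fin m} {f : Eucl m → ℝ} {g : Eucl m → F}
    {x : Eucl m} (hf : DifferentiableAt ℝ f x) (hg : DifferentiableAt ℝ g x) :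
    pd i (fun y => f y • g y) x = f x • pd i g x + pd i f x • g x :=
  pd_bilin (ContinuousLinearMap.lsmul ℝ ℝ) hf hg

theorem pd_coord (i j : Fin m) (x : Eucl m) :
    pd i (fun y : Eucl m => y j) x = if j = i then 1 else 0 := by
  have : (fun y : Eucl m => y j) = EuclideanSpace.proj (𝕜 := ℝ) j := rfl
  rw [pd, this, ContinuousLinearMap.fderiv]
  simp

theorem differentiableAt_coord (j : Fin m) (x : Eucl m) :
    DifferentiableAt ℝ (fun y : Eucl m => y j) x :=
  (EuclideanSpace.proj (𝕜 := ℝ) j).differentiableAt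

theorem pd_norm_zpow (a : ℤ) (i : Fin m) {x : Eucl m} (hx : x ≠ 0) :
    pd i (fun y : Eucl m => ‖y‖ ^ a) x = a * ‖x‖ ^ (a - 2) * x i := by
  have hx' : ‖x‖ ≠ 0 := norm_ne_zero_iff.2 hx
  have h1 : HasFDerivAt (fun y : Eucl m => ‖y‖) (‖x‖⁻¹ • innerSL ℝ x) x := by
    have := (hasStrictFDerivAt_norm_sq x).hasFDerivAt.sqrt (by positivity)
    simp only [Real.sqrt_sq (norm_nonneg _)] at this
    convert! this using 1
    ext y
    simp
    field_simp
  have h2 := (hasDerivAt_zpow a ‖x‖ (Or.inl hx')).comp_hasFDerivAt x h1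
  rw [pd]
  have h3 : (fun y : Eucl m => ‖y‖ ^ a) = (fun t : ℝ => t ^ a) ∘ fun y : Eucl m => ‖y‖ := rfl
  rw [h3, h2.fderiv]
  have h4 : ‖x‖ ^ (a - 1) = ‖x‖ ^ (a - 2) * ‖x‖ := by
    rw [← zpow_add_one₀ hx']; ring_nf
  simp [h4, EuclideanSpace.inner_single_right]
  field_simp

theorem sum_single_smul (x : Eucl m) : ∑ i, x i • EuclideanSpace.single i (1 : ℝ) = x := by
  ext j
  simp [Pi.single_apply]

namespace IsHomog

variable {d e : ℤ} {f : Eucl m → F} {g : Eucl m → F}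

theorem contDiffAt (hf : IsHomog d f) {x : Eucl m} (hx : x ≠ 0) : ContDiffAt ℝ ∞ f x :=
  hf.contDiffOn.contDiffAt (compl_zero_mem_nhds hx)

theorem differentiableAt (hf : IsHomog d f) {x : Eucl m} (hx : x ≠ 0) :
    DifferentiableAt ℝ f x := (hf.contDiffAt hx).differentiableAt (by simp)

theorem continuousOn (hf : IsHomog d f) : ContinuousOn f {0}ᶜ := hf.contDiffOn.continuousOn

theorem congr (hf : IsHomog d f) (h : EqOn g f {0}ᶜ) : IsHomog d g where
  contDiffOn := hf.contDiffOn.congr h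
  map_smul t ht x hx := by
    rw [h hx, h (show t • x ≠ 0 from smul_ne_zero ht.ne' hx), hf.map_smul t ht x hx]

theorem add (hf : IsHomog d f) (hg : IsHomog d g) : IsHomog d (fun x => f x + g x) where
  contDiffOn := hf.contDiffOn.add hg.contDiffOn
  map_smul t ht x hx := by simp [hf.map_smul t ht x hx, hg.map_smul t ht x hx]

theorem bilin (B : F →L[ℝ] G →L[ℝ] H) {g : Eucl m → G} (hf : IsHomog d f) (hg : IsHomog e g) :
    IsHomog (d + e) (fun x => B (f x) (g x)) where
  contDiffOn := B.isBoundedBilinearMap.contDiff.comp₂_contDiffOn hf.contDiffOn hg.contDiffOn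
  map_smul t ht x hx := by
    simp only [hf.map_smul t ht x hx, hg.map_smul t ht x hx, _root_.map_smul, smul_apply,
      zpow_add₀ ht.ne', mul_smul]
    rw [smul_comm]

theorem smul {f : Eucl m → ℝ} (hf : IsHomog d f) (hg : IsHomog e g) :
    IsHomog (d + e) (fun x => f x • g x) :=
  hf.bilin (ContinuousLinearMap.lsmul ℝ ℝ) hg

theorem const (v : F) : IsHomog 0 (fun _ : Eucl m => v) where
  contDiffOn := contDiffOn_const
  map_smul t ht x hx := by simp

theorem const_smul (c : ℝ) (hf : IsHomog d f) : IsHomog d (fun x => c • f x) := by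
  simpa using (IsHomog.const (m := m) c).smul hf

theorem sum {ι : Type*} {s : Finset ι} {f : ι → Eucl m → F} (hf : ∀ j ∈ s, IsHomog d (f j)) :
    IsHomog d (fun x => ∑ j ∈ s, f j x) where
  contDiffOn := ContDiffOn.sum fun j hj => (hf j hj).contDiffOn
  map_smul t ht x hx := by
    rw [Finset.smul_sum]
    exact Finset.sum_congr rfl fun j hj => (hf j hj).map_smul t ht x hx

theorem fderiv_smul (hf : IsHomog d f) {t : ℝ} (ht : 0 < t) {x : Eucl m} (hx : x ≠ 0) :
    fderiv ℝ f (t • x) = t ^ (d - 1) • fderiv ℝ f x := by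
  have h1 : (fun y => f (t • y)) =ᶠ[𝓝 x] t ^ d • f := by
    filter_upwards [compl_zero_mem_nhds hx] with y hy using hf.map_smul t ht y hy
  have h2 := h1.fderiv_eq (𝕜 := ℝ)
  rw [fderiv_comp_smul, fderiv_const_smul_field, Pi.smul_apply] at h2
  rw [zpow_sub_one₀ ht.ne', mul_comm, mul_smul, ← h2, inv_smul_smul₀ ht.ne']

protected theorem pd (hf : IsHomog d f) (i : Fin m) : IsHomog (d - 1) (pd i f) where
  contDiffOn := (hf.contDiffOn.fderiv_of_isOpen isOpen_compl_singleton (by simp)).clm_apply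
    contDiffOn_const
  map_smul t ht x hx := by
    simp [pd, hf.fderiv_smul ht hx]

protected theorem lap (hf : IsHomog d f) : IsHomog (d - 2) (lap f) :=
  .sum fun i _ => by simpa [sub_sub] using (hf.pd i).pd i

/-- **Euler's identity** for homogeneous functions. -/
theorem euler (hf : IsHomog d f) {x : Eucl m} (hx : x ≠ 0) :
    ∑ i, x i • pd i f x = (d : ℝ) • f x := by
  have h1 : ∑ i, x i • pd i f x = fderiv ℝ f x x := by
    conv_rhs => rw [← sum_single_smul x, map_sum]
    simp only [pd, _root_.map_smul, sum_single_smul]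
  have h2 : HasDerivAt (fun t : ℝ => f (t • x)) (fderiv ℝ f x x) 1 := by
    have h3 : HasDerivAt (fun t : ℝ => t • x) x 1 := by
      simpa using (hasDerivAt_id (1 : ℝ)).smul_const x
    have h4 : HasFDerivAt f (fderiv ℝ f x) ((1 : ℝ) • x) := by
      rw [one_smul]; exact (hf.differentiableAt hx).hasFDerivAt
    exact h4.comp_hasDerivAt 1 h3
  have h5 : HasDerivAt (fun t : ℝ => t ^ d • f x) ((d : ℝ) • f x) 1 := by
    simpa using (hasDerivAt_zpow d (1 : ℝ) (Or.inl one_ne_zero)).smul_const (f x)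
  have h6 : (fun t : ℝ => f (t • x)) =ᶠ[𝓝 1] fun t => t ^ d • f x := by
    filter_upwards [lt_mem_nhds (zero_lt_one (α := ℝ))] with t ht using hf.map_smul t ht x hx
  rw [h1]
  exact h2.unique (h5.congr_of_eventuallyEq h6)

theorem norm_le (hf : IsHomog d f) : ∃ C, 0 ≤ C ∧ ∀ x ≠ 0, ‖f x‖ ≤ C * ‖x‖ ^ d := by
  have hsub : Metric.sphere (0 : Eucl m) 1 ⊆ {0}ᶜ := fun x hx h => by
    simp [mem_singleton_iff.1 h] at hx
  obtain ⟨C, hC⟩ := (isCompact_sphere (0 : Eucl m) 1).exists_bound_of_continuousOn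
    (hf.continuousOn.mono hsub)
  refine ⟨max C 0, le_max_right _ _, fun x hx => ?_⟩
  have hx' : 0 < ‖x‖ := norm_pos_iff.2 hx
  have h1 : ‖x‖⁻¹ • x ∈ Metric.sphere (0 : Eucl m) 1 := by
    simp [norm_smul, hx'.ne']
  have h2 := hf.map_smul ‖x‖ hx' (‖x‖⁻¹ • x) (hsub h1)
  rw [smul_inv_smul₀ hx'.ne'] at h2
  rw [h2, norm_smul, mul_comm, norm_zpow, norm_norm]
  gcongr
  exact (hC _ h1).trans (le_max_left _ _)

theorem coord (j : Fin m) : IsHomog 1 (fun x : Eucl m => x j) where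
  contDiffOn := (EuclideanSpace.proj (𝕜 := ℝ) j).contDiff.contDiffOn
  map_smul t ht x hx := by simp

theorem norm_zpow (a : ℤ) : IsHomog a (fun x : Eucl m => ‖x‖ ^ a) where
  contDiffOn := fun x hx => by
    have h : ContDiffAt ℝ ∞ (fun x : Eucl m => ‖x‖) x := contDiffAt_norm ℝ hx
    have h' : ‖x‖ ≠ 0 := norm_ne_zero_iff.2 hx
    refine ContDiffAt.contDiffWithinAt ?_
    obtain ⟨n, rfl | rfl⟩ := a.eq_nat_or_neg
    · simpa using h.pow n
    · simpa using! (h.pow n).inv (pow_ne_zero n h')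
  map_smul t ht x hx := by
    rw [norm_smul, mul_zpow, Real.norm_of_nonneg ht.le, smul_eq_mul]

theorem pd_comm (hf : IsHomog d f) (i j : Fin m) {x : Eucl m} (hx : x ≠ 0) :
    pd i (pd j f) x = pd j (pd i f) x := by
  have hd : DifferentiableAt ℝ (fderiv ℝ f) x :=
    ((hf.contDiffAt hx).fderiv_right (m := 1) (by norm_cast)).differentiableAt (by simp)
  have key : ∀ i j : Fin m, pd i (pd j f) x =
      fderiv ℝ (fderiv ℝ f) x (EuclideanSpace.single i 1) (EuclideanSpace.single j 1) := by
    intro i j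
    have h := fderiv_clm_apply hd (differentiableAt_const (EuclideanSpace.single j (1 : ℝ)))
    have h' : pd j f = fun y => fderiv ℝ f y (EuclideanSpace.single j 1) := rfl
    rw [pd, h', h]
    simp
  rw [key, key]
  have h2 : minSmoothness ℝ 2 ≤ ∞ := by
    simpa using! WithTop.coe_le_coe.2 (le_top : (2 : ℕ∞) ≤ ⊤)
  exact ((hf.contDiffAt hx).isSymmSndFDerivAt h2).eq _ _

theorem lap_pd (hf : IsHomog d f) (i : Fin m) :
    EqOn (lap (pd i f)) (pd i (lap f)) {0}ᶜ := fun x hx => by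
  have h : pd i (lap f) x = ∑ j, pd i (pd j (pd j f)) x :=
    pd_sum fun j _ => ((hf.pd j).pd j).differentiableAt hx
  rw [h, lap]
  refine Finset.sum_congr rfl fun j _ => ?_
  rw [pd_congr (fun y hy => hf.pd_comm j i hy) hx, (hf.pd j).pd_comm j i hx]

/-- The Laplacian of `rᵃ f` for a harmonic function `f` that is homogeneous of degree `d`. -/
theorem lap_norm_zpow_smul (hf : IsHomog d f) (hlap : EqOn (lap f) 0 {0}ᶜ)
    (a : ℤ) : EqOn (lap fun x => ‖x‖ ^ a • f x)
      (fun x => ((a : ℝ) * (m + a - 2 + 2 * d)) • ‖x‖ ^ (a - 2) • f x) {0}ᶜ := fun x hx => by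
  have hr : ‖x‖ ≠ 0 := norm_ne_zero_iff.2 hx
  have h1 : ∀ i, EqOn (pd i fun x => ‖x‖ ^ a • f x)
      (fun x => ‖x‖ ^ a • pd i f x + (a : ℝ) • ‖x‖ ^ (a - 2) • x i • f x) {0}ᶜ := fun i y hy => by
    rw [pd_smul ((norm_zpow a).differentiableAt hy) (hf.differentiableAt hy),
      pd_norm_zpow a i hy]
    simp only [smul_smul, mul_assoc]
  have h2 : ∀ i, pd i (pd i fun x => ‖x‖ ^ a • f x) x =
      ‖x‖ ^ a • pd i (pd i f) x
      + (2 * a * ‖x‖ ^ (a - 2)) • x i • pd i f x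
      + (a * ‖x‖ ^ (a - 2)) • f x
      + (a * (a - 2) * ‖x‖ ^ (a - 4) * x i ^ 2) • f x := fun i => by
    have hxf : DifferentiableAt ℝ (fun y : Eucl m => y i • f y) x :=
      (differentiableAt_coord i x).smul (hf.differentiableAt hx)
    rw [pd_congr (h1 i) hx,
      pd_add (((norm_zpow a).smul (hf.pd i)).differentiableAt hx)
        (((norm_zpow (a - 2)).smul ((coord i).smul hf)).const_smul (a : ℝ) |>.differentiableAt hx),
      pd_smul ((norm_zpow a).differentiableAt hx) ((hf.pd i).differentiableAt hx),
      pd_const_smul,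
      pd_smul ((norm_zpow (a - 2)).differentiableAt hx) hxf,
      pd_smul (differentiableAt_coord i x) (hf.differentiableAt hx), pd_coord,
      pd_norm_zpow _ i hx, pd_norm_zpow _ i hx]
    have : a - 2 - 2 = a - 4 := by ring
    rw [this]
    push_cast
    simp only [if_true]
    module
  have hsq : ∑ i, x i ^ 2 = ‖x‖ ^ 2 := by
    rw [EuclideanSpace.norm_sq_eq]; simp
  have h0 : ∑ i, pd i (pd i f) x = 0 := hlap hx
  rw [lap]
  simp only [h2, Finset.sum_add_distrib, ← Finset.smul_sum, ← Finset.sum_smul, hf.euler hx,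
    ← Finset.mul_sum, hsq, h0]
  have h4 : ‖x‖ ^ (a - 2) = ‖x‖ ^ (a - 4) * ‖x‖ ^ 2 := by
    rw [← zpow_natCast ‖x‖ 2, ← zpow_add₀ hr]
    congr 1
    push_cast
    ring
  simp only [Finset.sum_const, Finset.card_univ, Fintype.card_fin, h4,
    ← Nat.cast_smul_eq_nsmul ℝ]
  module

end IsHomog

end Calculus

/-! ### Integration by parts across a point singularity -/

section PointSingularity

variable {m : ℕ} {F G H : Type*} [NormedAddCommGroup F] [NormedSpace ℝ F]
  [NormedAddCommGroup G] [NormedSpace ℝ G] [NormedAddCommGroup H] [NormedSpace ℝ H]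
  {d : ℤ} {f : Eucl m → F}

theorem IsHomog.aestronglyMeasurable (hm : 0 < m) (hf : IsHomog d f) :
    AEStronglyMeasurable f volume := by
  have : Nonempty (Fin m) := ⟨⟨0, hm⟩⟩
  rw [← restrict_compl_singleton (μ := volume) (0 : Eucl m)]
  exact hf.continuousOn.aestronglyMeasurable isOpen_compl_singleton.measurableSet

theorem ae_ne_zero (hm : 0 < m) : ∀ᵐ x : Eucl m, x ≠ 0 := by
  have : Nonempty (Fin m) := ⟨⟨0, hm⟩⟩
  exact Measure.ae_ne volume 0

theorem IsHomog.locallyIntegrable (hm : 0 < m) (hf : IsHomog d f) (hd : 0 < d + m) :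
    LocallyIntegrable f volume := by
  obtain ⟨C, hC, h⟩ := hf.norm_le
  refine locallyIntegrable_of_norm_le_rpow (C := C) (α := -d)
    (by simpa using Nat.one_le_of_lt hm) ?_ ?_ (hf.aestronglyMeasurable hm)
  · have : (0 : ℝ) < d + m := by exact_mod_cast hd
    simp only [finrank_euclideanSpace, Fintype.card_fin]
    linarith
  · filter_upwards [ae_ne_zero hm] with x hx
    simpa using h x hx

theorem IsHomog.memLp_ball (hm : 0 < m) (hf : IsHomog d f) (hd : 0 < 2 * d + m) :
    MemLp f 2 (volume.restrict (Metric.ball (0 : Eucl m) 1)) := by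
  obtain ⟨C, hC, h⟩ := hf.norm_le
  have hmeas := hf.aestronglyMeasurable hm
  refine (memLp_two_iff_integrable_sq_norm hmeas.restrict).2 ?_
  refine integrableOn_ball_of_norm_le_rpow (C := C ^ 2) (α := -(2 * d : ℤ))
    (by simpa using Nat.one_le_of_lt hm) ?_ ?_ (hmeas.norm.pow 2)
  · have : (0 : ℝ) < (2 * d : ℤ) + m := by exact_mod_cast hd
    simp only [finrank_euclideanSpace, Fintype.card_fin]
    linarith
  · refine ae_restrict_of_ae ?_
    filter_upwards [ae_ne_zero hm] with x hx
    have h' := pow_le_pow_left₀ (norm_nonneg _) (h x hx) 2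
    rw [neg_neg, Real.rpow_intCast, norm_pow, norm_norm]
    rwa [mul_pow, ← zpow_natCast (‖x‖ ^ d) 2, ← zpow_mul, mul_comm d] at h'

/-- The cutoff function at distance `1 / √N` from the origin: it vanishes for `N ‖x‖² ≤ 1` and
equals `1` for `N ‖x‖² ≥ 2`. -/
noncomputable def cutoff (N : ℝ) (x : Eucl m) : ℝ := Real.smoothTransition (N * ‖x‖ ^ 2 - 1)

theorem contDiff_cutoff (N : ℝ) : ContDiff ℝ ∞ (cutoff (m := m) N) :=
  Real.smoothTransition.contDiff.comp ((contDiff_const.mul (contDiff_norm_sq ℝ)).sub contDiff_const)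

theorem tsupport_cutoff_subset (N : ℝ) : tsupport (cutoff (m := m) N) ⊆ {0}ᶜ := by
  have h1 : IsClosed {x : Eucl m | 1 ≤ N * ‖x‖ ^ 2} :=
    isClosed_le continuous_const (by fun_prop)
  have h2 : Function.support (cutoff (m := m) N) ⊆ {x : Eucl m | 1 ≤ N * ‖x‖ ^ 2} := by
    intro x hx
    by_contra h
    simp only [mem_ofPred_eq, not_le] at h
    exact hx (Real.smoothTransition.zero_of_nonpos (by linarith))
  refine (closure_minimal h2 h1).trans fun x hx h => ?_
  rw [mem_singleton_iff] at h
  simp only [mem_ofPred_eq, h, norm_zero] at hx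
  norm_num at hx

theorem eventually_cutoff_eq_one {x : Eucl m} (hx : x ≠ 0) :
    ∀ᶠ n : ℕ in atTop, cutoff (n : ℝ) =ᶠ[𝓝 x] fun _ => 1 := by
  have hx' : 0 < ‖x‖ := norm_pos_iff.2 hx
  obtain ⟨n₀, hn₀⟩ := exists_nat_gt (2 / ‖x‖ ^ 2)
  filter_upwards [eventually_ge_atTop n₀] with n hn
  have h1 : 2 < (n : ℝ) * ‖x‖ ^ 2 := by
    rw [div_lt_iff₀ (by positivity)] at hn₀
    have : (n₀ : ℝ) ≤ n := by exact_mod_cast hn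
    nlinarith [sq_nonneg ‖x‖]
  have h2 : ∀ᶠ y in 𝓝 x, 2 < (n : ℝ) * ‖y‖ ^ 2 :=
    (Continuous.tendsto (f := fun y : Eucl m => (n : ℝ) * ‖y‖ ^ 2)
      (by fun_prop) x).eventually_const_lt h1
  filter_upwards [h2] with y hy
  exact Real.smoothTransition.one_of_one_le (by linarith)

theorem deriv_smoothTransition_eq_zero {s : ℝ} (hs : s ∉ Icc (0 : ℝ) 1) :
    deriv Real.smoothTransition s = 0 := by
  simp only [mem_Icc, not_and_or, not_le] at hs
  rcases hs with hs | hs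
  · have : Real.smoothTransition =ᶠ[𝓝 s] fun _ => 0 := by
      filter_upwards [gt_mem_nhds hs] with t ht
      exact Real.smoothTransition.zero_of_nonpos ht.le
    rw [this.deriv_eq, deriv_const]
  · have : Real.smoothTransition =ᶠ[𝓝 s] fun _ => 1 := by
      filter_upwards [lt_mem_nhds hs] with t ht
      exact Real.smoothTransition.one_of_one_le ht.le
    rw [this.deriv_eq, deriv_const]

theorem pd_cutoff (N : ℝ) (i : Fin m) (x : Eucl m) :
    pd i (cutoff N) x = deriv Real.smoothTransition (N * ‖x‖ ^ 2 - 1) * (N * (2 * x i)) := by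
  have h1 : HasFDerivAt (fun y : Eucl m => N * ‖y‖ ^ 2 - 1) (N • (2 • innerSL ℝ x)) x :=
    ((hasStrictFDerivAt_norm_sq x).hasFDerivAt.const_mul N).sub_const 1
  have h2 : HasDerivAt Real.smoothTransition
      (deriv Real.smoothTransition (N * ‖x‖ ^ 2 - 1)) (N * ‖x‖ ^ 2 - 1) :=
    ((Real.smoothTransition.contDiff (n := 1)).differentiable (by simp) _).hasDerivAt
  have h3 := h2.comp_hasFDerivAt x h1
  have h4 : cutoff (m := m) N = Real.smoothTransition ∘ fun y : Eucl m => N * ‖y‖ ^ 2 - 1 := rfl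
  have h5 : innerSL ℝ x (EuclideanSpace.single i 1) = x i := by
    simp [EuclideanSpace.inner_single_right]
  rw [pd, h4, h3.fderiv]
  simp only [smul_apply, h5, smul_eq_mul, nsmul_eq_mul, Nat.cast_ofNat]

/-- The gradients of the cutoff functions are bounded by a multiple of `1 / r`, uniformly in the
cutoff radius. -/
theorem exists_pd_cutoff_le : ∃ K : ℝ, ∀ (N : ℝ), 0 ≤ N → ∀ (i : Fin m) (x : Eucl m),
    |pd i (cutoff N) x| ≤ K * ‖x‖⁻¹ := by
  have hcont : Continuous (fun s => deriv Real.smoothTransition s * (s + 1)) :=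
    ((Real.smoothTransition.contDiff (n := 1)).continuous_deriv le_rfl).mul (by fun_prop)
  obtain ⟨K, hK⟩ := isCompact_Icc.exists_bound_of_continuousOn
    (s := Icc (0 : ℝ) 1) hcont.continuousOn
  have hK0 : 0 ≤ K := (norm_nonneg _).trans (hK 0 (by simp))
  have hK' : ∀ s, ‖deriv Real.smoothTransition s * (s + 1)‖ ≤ K := fun s => by
    by_cases hs : s ∈ Icc (0 : ℝ) 1
    · exact hK s hs
    · simpa [deriv_smoothTransition_eq_zero hs] using hK0
  refine ⟨2 * K, fun N hN i x => ?_⟩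
  have h5 := hK' (N * ‖x‖ ^ 2 - 1)
  rw [pd_cutoff]
  set D := deriv Real.smoothTransition (N * ‖x‖ ^ 2 - 1)
  have h6 : |x i| ≤ ‖x‖ := by simpa using PiLp.norm_apply_le x i
  rcases eq_or_ne x 0 with rfl | hx
  · simp
  have hx' : 0 < ‖x‖ := norm_pos_iff.2 hx
  rw [← div_eq_mul_inv, le_div_iff₀ hx']
  rw [sub_add_cancel, Real.norm_eq_abs, abs_mul,
    abs_of_nonneg (show 0 ≤ N * ‖x‖ ^ 2 by positivity)] at h5
  calc _ = |D| * N * (2 * |x i|) * ‖x‖ := by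
        simp only [abs_mul, abs_of_nonneg hN, abs_two]
        ring
    _ ≤ |D| * N * (2 * ‖x‖) * ‖x‖ := by gcongr
    _ = 2 * (|D| * (N * ‖x‖ ^ 2)) := by ring
    _ ≤ 2 * K := by linarith

/-- A function that is differentiable off the origin has no distributional contribution at the
origin as soon as the function itself, its derivative and its quotient by `r` are integrable. -/
theorem integral_pd_eq_zero {g : Eucl m → F} {i : Fin m} (hg : DifferentiableOn ℝ g {0}ᶜ)
    (h0 : Integrable g) (h1 : Integrable (pd i g)) (h2 : Integrable fun x => ‖x‖⁻¹ • g x) :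
    ∫ x, pd i g x = 0 := by
  have hm : 0 < m := i.pos
  obtain ⟨K, hK⟩ := exists_pd_cutoff_le (m := m)
  have hcont : ∀ N, Continuous (cutoff (m := m) N) := fun N => (contDiff_cutoff N).continuous
  have hcont' : ∀ N, Continuous (pd i (cutoff (m := m) N)) := fun N =>
    ((contDiff_cutoff N).continuous_fderiv (by simp)).clm_apply continuous_const
  have hbd : ∀ N (x : Eucl m), ‖cutoff N x‖ ≤ 1 := fun N x => by
    rw [cutoff, Real.norm_eq_abs, abs_of_nonneg (Real.smoothTransition.nonneg _)]
    exact Real.smoothTransition.le_one _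
  have hle : ∀ n : ℕ, ∀ x, ‖pd i (cutoff (n : ℝ)) x • g x‖ ≤ K * ‖‖x‖⁻¹ • g x‖ := fun n x => by
    rw [norm_smul, norm_smul, norm_inv, norm_norm, ← mul_assoc]
    exact mul_le_mul_of_nonneg_right (hK n n.cast_nonneg i x) (norm_nonneg _)
  have hle1 : ∀ (n : ℕ) {g : Eucl m → F} (x), ‖cutoff (n : ℝ) x • g x‖ ≤ ‖g x‖ := fun n g x => by
    rw [norm_smul]
    exact mul_le_of_le_one_left (norm_nonneg _) (hbd _ _)
  have hpart : ∀ n : ℕ, ∫ x, cutoff (n : ℝ) x • pd i g x = -∫ x, pd i (cutoff (n : ℝ)) x • g x := by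
    intro n
    refine integral_smul_fderiv_eq_neg_fderiv_smul_of_integrable ?_ ?_ ?_ ?_ ?_
    · exact (h2.norm.const_mul K).mono' ((hcont' n).aestronglyMeasurable.smul h0.1)
        (Eventually.of_forall (hle n))
    · exact h1.norm.mono' ((hcont n).aestronglyMeasurable.smul h1.1)
        (Eventually.of_forall fun x => hle1 n (g := pd i g) x)
    · exact h0.norm.mono' ((hcont n).aestronglyMeasurable.smul h0.1)
        (Eventually.of_forall fun x => hle1 n x)
    · exact fun x _ => (contDiff_cutoff (n : ℝ)).differentiable (by simp) x
    · exact fun x hx => hg.differentiableAt (compl_zero_mem_nhds (tsupport_cutoff_subset _ hx))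
  have hl : Tendsto (fun n : ℕ => ∫ x, cutoff (n : ℝ) x • pd i g x) atTop (𝓝 (∫ x, pd i g x)) := by
    refine tendsto_integral_of_dominated_convergence (fun x => ‖pd i g x‖)
      (fun n => (hcont n).aestronglyMeasurable.smul h1.1) h1.norm
      (fun n => Eventually.of_forall fun x => hle1 n (g := pd i g) x) ?_
    filter_upwards [ae_ne_zero hm] with x hx
    refine tendsto_const_nhds.congr' ?_
    filter_upwards [eventually_cutoff_eq_one hx] with n hn
    rw [hn.eq_of_nhds, one_smul]
  have hr : Tendsto (fun n : ℕ => ∫ x, pd i (cutoff (n : ℝ)) x • g x) atTop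
      (𝓝 (∫ _ : Eucl m, (0 : F))) := by
    refine tendsto_integral_of_dominated_convergence (fun x => K * ‖‖x‖⁻¹ • g x‖)
      (fun n => (hcont' n).aestronglyMeasurable.smul h0.1) (h2.norm.const_mul K)
      (fun n => Eventually.of_forall (hle n)) ?_
    filter_upwards [ae_ne_zero hm] with x hx
    refine tendsto_const_nhds.congr' ?_
    filter_upwards [eventually_cutoff_eq_one hx] with n hn
    simp [pd, hn.fderiv_eq]
  simp only [hpart] at hl
  have := tendsto_nhds_unique hl hr.neg
  simpa using this

theorem integrable_bilin (B : F →L[ℝ] G →L[ℝ] H) {φ : Eucl m → F} {g : Eucl m → G}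
    (hφ : Continuous φ) (hc : HasCompactSupport φ) (hg : LocallyIntegrable g volume) :
    Integrable fun x => B (φ x) (g x) := by
  have h1 := (hg.integrable_smul_left_of_hasCompactSupport (hφ.norm) hc.norm).norm.const_mul ‖B‖
  refine h1.mono' (B.aestronglyMeasurable_comp₂ hφ.aestronglyMeasurable hg.aestronglyMeasurable)
    (Eventually.of_forall fun x => ?_)
  rw [norm_smul, norm_norm, ← mul_assoc]
  exact B.le_opNorm₂ _ _

theorem IsTestFunction.pd {Ω : Set (Eucl m)} {φ : Eucl m → F} (hφ : IsTestFunction Ω φ)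
    (i : Fin m) : IsTestFunction Ω (pd i φ) := by
  refine ⟨(hφ.1.fderiv_right (by simp)).clm_apply contDiff_const, hφ.2.1.fderiv_apply ℝ _,
    subset_trans ?_ hφ.2.2⟩
  exact tsupport_fderiv_apply_subset ℝ _

/-- Integration by parts of a homogeneous function against a test function; the degree condition
makes the derivative of the homogeneous function locally integrable. -/
theorem IsHomog.integral_bilin_pd {g : Eucl m → G} (hg : IsHomog d g) (hd : 1 < d + m)
    (B : F →L[ℝ] G →L[ℝ] H) {Ω : Set (Eucl m)} {φ : Eucl m → F} (hφ : IsTestFunction Ω φ)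
    (i : Fin m) :
    ∫ x, B (ExtrinsicHarmonic.pd i φ x) (g x) = -∫ x, B (φ x) (ExtrinsicHarmonic.pd i g x) := by
  have hm : 0 < m := i.pos
  have hφd : Differentiable ℝ φ := hφ.1.differentiable (by simp)
  have hpd : EqOn (ExtrinsicHarmonic.pd i fun x => B (φ x) (g x))
      (fun x => B (φ x) (ExtrinsicHarmonic.pd i g x) + B (ExtrinsicHarmonic.pd i φ x) (g x))
      {0}ᶜ := fun x hx => pd_bilin B (hφd x) (hg.differentiableAt hx)
  have hpd' := (ae_ne_zero hm).mono fun x hx => hpd hx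
  have i0 := integrable_bilin B hφ.1.continuous hφ.2.1 (hg.locallyIntegrable hm (by lia))
  have i1 := integrable_bilin B hφ.1.continuous hφ.2.1
    ((hg.pd i).locallyIntegrable hm (by lia))
  have i2 := integrable_bilin B (hφ.pd i).1.continuous (hφ.pd i).2.1
    (hg.locallyIntegrable hm (by lia))
  have i3 := integrable_bilin B hφ.1.continuous hφ.2.1
    (((norm_zpow (m := m) (-1)).smul hg).locallyIntegrable hm (by lia))
  have key := integral_pd_eq_zero (g := fun x => B (φ x) (g x)) (i := i)
    (fun x hx => (B.hasFDerivAt_of_bilinear (hφd x).hasFDerivAt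
      (hg.differentiableAt hx).hasFDerivAt).differentiableAt.differentiableWithinAt)
    i0 ((i1.add i2).congr (hpd'.mono fun x hx => hx.symm)) (by simpa using i3)
  rw [integral_congr_ae hpd', integral_add i1 i2] at key
  exact eq_neg_of_add_eq_zero_right key

end PointSingularity

/-! ### Weak partial derivatives and Sobolev spaces -/

section WeakDerivatives

variable {m : ℕ} {F : Type*} [NormedAddCommGroup F] [InnerProductSpace ℝ F]
  {Ω : Set (Eucl m)} {i : Fin m} {k : ℕ} {u v g h : Eucl m → F}

theorem IsTestFunction.eq_zero {G : Type*} [NormedAddCommGroup G] [NormedSpace ℝ G]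
    {φ : Eucl m → G} (hφ : IsTestFunction Ω φ) {x : Eucl m} (hx : x ∉ Ω) : φ x = 0 :=
  image_eq_zero_of_notMem_tsupport fun h => hx (hφ.2.2 h)

theorem IsTestFunction.integrable_smul {φ : Eucl m → ℝ} (hΩ : IsOpen Ω) (hφ : IsTestFunction Ω φ)
    (hu : LocallyIntegrableOn u Ω) : Integrable (fun x => φ x • u x) (volume.restrict Ω) := by
  have h1 : IntegrableOn (fun x => φ x • u x) (tsupport φ) :=
    (hu.integrableOn_compact_subset hφ.2.2 hφ.2.1).continuousOn_smul hφ.1.continuous.continuousOn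
      hφ.2.1
  refine h1.of_forall_sdiff_eq_zero hΩ.measurableSet fun x hx => ?_
  rw [image_eq_zero_of_notMem_tsupport hx.2, zero_smul]

theorem IsTestFunction.memLp {φ : Eucl m → F} (hφ : IsTestFunction Ω φ) :
    MemLp φ 2 (volume.restrict Ω) :=
  hφ.1.continuous.memLp_of_hasCompactSupport hφ.2.1

theorem HasWeakPartial.integral_pd (H : HasWeakPartial Ω i u g) {φ : Eucl m → ℝ}
    (hφ : IsTestFunction Ω φ) : ∫ x in Ω, pd i φ x • u x = -∫ x in Ω, φ x • g x :=
  H.2.2 φ hφ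

theorem HasWeakPartial.congr (hu : u =ᵐ[volume.restrict Ω] v) (hg : g =ᵐ[volume.restrict Ω] h)
    (H : HasWeakPartial Ω i u g) : HasWeakPartial Ω i v h := by
  refine ⟨H.1.congr hu, H.2.1.congr hg, fun φ hφ => ?_⟩
  have h1 : ∫ x in Ω, (fderiv ℝ φ x (EuclideanSpace.single i 1)) • v x =
      ∫ x in Ω, (fderiv ℝ φ x (EuclideanSpace.single i 1)) • u x :=
    integral_congr_ae (hu.mono fun x hx => by simp only [hx])
  have h2 : ∫ x in Ω, φ x • h x = ∫ x in Ω, φ x • g x :=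
    integral_congr_ae (hg.mono fun x hx => by simp only [hx])
  rw [h1, h2, H.2.2 φ hφ]

theorem HasWeakPartial.ae_eq [CompleteSpace F] (hΩ : IsOpen Ω) (hg : HasWeakPartial Ω i u g)
    (hh : HasWeakPartial Ω i u h) : g =ᵐ[volume.restrict Ω] h := by
  have key : ∀ᵐ x, x ∈ Ω → (g - h) x = 0 := by
    refine hΩ.ae_eq_zero_of_integral_contDiff_smul_eq_zero (hg.2.1.sub hh.2.1)
      fun φ h1 h2 h3 => ?_
    have hφ : IsTestFunction Ω φ := ⟨h1, h2, h3⟩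
    rw [← setIntegral_eq_integral_of_forall_compl_eq_zero (s := Ω)
      fun x hx => by rw [hφ.eq_zero hx, zero_smul]]
    simp only [Pi.sub_apply, smul_sub]
    rw [integral_sub (hφ.integrable_smul hΩ hg.2.1) (hφ.integrable_smul hΩ hh.2.1), sub_eq_zero]
    exact neg_injective ((hg.2.2 φ hφ).symm.trans (hh.2.2 φ hφ))
  filter_upwards [(ae_restrict_iff' hΩ.measurableSet).2 key] with x hx using sub_eq_zero.1 hx

theorem HasWeakPartial.add (hΩ : IsOpen Ω) (hu : HasWeakPartial Ω i u g)
    (hv : HasWeakPartial Ω i v h) : HasWeakPartial Ω i (u + v) (g + h) := by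
  refine ⟨hu.1.add hv.1, hu.2.1.add hv.2.1, fun φ hφ => ?_⟩
  change ∫ x in Ω, pd i φ x • (u + v) x = _
  simp only [Pi.add_apply, smul_add]
  rw [integral_add (hφ.integrable_smul hΩ hu.2.1) (hφ.integrable_smul hΩ hv.2.1),
    integral_add ((hφ.pd i).integrable_smul hΩ hu.1) ((hφ.pd i).integrable_smul hΩ hv.1),
    hu.integral_pd hφ, hv.integral_pd hφ, neg_add]

theorem HasWeakPartial.const_smul (c : ℝ) (hu : HasWeakPartial Ω i u g) :
    HasWeakPartial Ω i (c • u) (c • g) := by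
  have hl : ∀ {u : Eucl m → F}, LocallyIntegrableOn u Ω → LocallyIntegrableOn (c • u) Ω :=
    fun hu x hx => (hu x hx).smul c
  refine ⟨hl hu.1, hl hu.2.1, fun φ hφ => ?_⟩
  simp only [Pi.smul_apply, smul_comm _ c]
  rw [integral_smul, integral_smul, hu.2.2 φ hφ, smul_neg]

/-- If the degree exceeds `1 - m`, the derivative off the origin is a weak derivative across the
origin: it is locally integrable and has no singular part there. -/
theorem HasWeakPartial.of_isHomog {d : ℤ} (hu : IsHomog d u) (hd : 1 < d + m) (i : Fin m) :
    HasWeakPartial Ω i u (pd i u) := by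
  refine ⟨(hu.locallyIntegrable i.pos (by lia)).locallyIntegrableOn _,
    ((hu.pd i).locallyIntegrable i.pos (by lia)).locallyIntegrableOn _, fun φ hφ => ?_⟩
  change ∫ x in Ω, pd i φ x • u x = _
  rw [setIntegral_eq_integral_of_forall_compl_eq_zero
      fun x hx => by rw [(hφ.pd i).eq_zero hx, zero_smul],
    setIntegral_eq_integral_of_forall_compl_eq_zero
      fun x hx => by rw [hφ.eq_zero hx, zero_smul]]
  exact hu.integral_bilin_pd hd (ContinuousLinearMap.lsmul ℝ ℝ) hφ i

theorem HasWeakPartial.of_isTestFunction (hu : IsTestFunction Ω u) (i : Fin m) :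
    HasWeakPartial Ω i u (pd i u) := by
  have hli : ∀ {w : Eucl m → F}, IsTestFunction Ω w → LocallyIntegrable w volume :=
    fun hw => hw.1.continuous.locallyIntegrable
  refine ⟨(hli hu).locallyIntegrableOn _, (hli (hu.pd i)).locallyIntegrableOn _, fun φ hφ => ?_⟩
  change ∫ x in Ω, pd i φ x • u x = _
  rw [setIntegral_eq_integral_of_forall_compl_eq_zero
      fun x hx => by rw [(hφ.pd i).eq_zero hx, zero_smul],
    setIntegral_eq_integral_of_forall_compl_eq_zero
      fun x hx => by rw [hφ.eq_zero hx, zero_smul], eq_neg_iff_add_eq_zero, add_comm,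
      ← eq_neg_iff_add_eq_zero]
  exact integral_smul_fderiv_eq_neg_fderiv_smul_of_integrable
    ((hli hu).integrable_smul_left_of_hasCompactSupport (hφ.pd i).1.continuous (hφ.pd i).2.1)
    ((hli (hu.pd i)).integrable_smul_left_of_hasCompactSupport hφ.1.continuous hφ.2.1)
    ((hli hu).integrable_smul_left_of_hasCompactSupport hφ.1.continuous hφ.2.1)
    (fun x _ => hφ.1.differentiable (by simp) x) (fun x _ => hu.1.differentiable (by simp) x)

theorem hasWeakPartial_weakPartial (hu : HasWeakPartial Ω i u g) :
    HasWeakPartial Ω i u (weakPartial Ω i u) := by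
  have hex : ∃ g, HasWeakPartial Ω i u g := ⟨g, hu⟩
  rw [weakPartial, dif_pos hex]
  exact hex.choose_spec

theorem HasWeakPartial.weakPartial_ae_eq [CompleteSpace F] (hΩ : IsOpen Ω)
    (hu : HasWeakPartial Ω i u g) : weakPartial Ω i u =ᵐ[volume.restrict Ω] g :=
  (hasWeakPartial_weakPartial hu).ae_eq hΩ hu

/-- Functions that agree almost everywhere have the same weak derivatives, hence the same chosen
representative `weakPartial`. -/
theorem weakPartial_congr (hu : u =ᵐ[volume.restrict Ω] v) :
    weakPartial Ω i u = weakPartial Ω i v := by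
  have : HasWeakPartial Ω i u = HasWeakPartial Ω i v := by
    ext g
    exact ⟨.congr hu .rfl, .congr hu.symm .rfl⟩
  classical
  exact congrArg (fun P : (Eucl m → F) → Prop => if h : ∃ g, P g then h.choose else 0) this

theorem MemW.memLp (hu : MemW Ω k u) : MemLp u 2 (volume.restrict Ω) := by
  cases k with
  | zero => exact hu
  | succ k => exact hu.1

theorem MemW.congr (huv : u =ᵐ[volume.restrict Ω] v) (hu : MemW Ω k u) : MemW Ω k v := by
  cases k with
  | zero => exact (memLp_congr_ae huv).1 hu
  | succ k =>
    refine ⟨(memLp_congr_ae huv).1 hu.1, fun i => ?_⟩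
    obtain ⟨g, h1, h2⟩ := hu.2 i
    exact ⟨g, h1.congr huv .rfl, h2⟩

theorem MemW.of_succ (hu : MemW Ω (k + 1) u) : MemW Ω k u := by
  induction k generalizing u with
  | zero => exact hu.1
  | succ k ih =>
    refine ⟨hu.1, fun i => ?_⟩
    obtain ⟨g, h1, h2⟩ := hu.2 i
    exact ⟨g, h1, ih h2⟩

theorem MemW.mono {j : ℕ} (hjk : j ≤ k) (hu : MemW Ω k u) : MemW Ω j u := by
  induction k, hjk using Nat.le_induction with
  | base => exact hu
  | succ k _ ih => exact ih hu.of_succ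

theorem MemW.hasWeakPartial (hu : MemW Ω (k + 1) u) (i : Fin m) :
    HasWeakPartial Ω i u (weakPartial Ω i u) :=
  let ⟨_, h1, _⟩ := hu.2 i
  hasWeakPartial_weakPartial h1

theorem MemW.add (hΩ : IsOpen Ω) (hu : MemW Ω k u) (hv : MemW Ω k v) : MemW Ω k (u + v) := by
  induction k generalizing u v with
  | zero => exact MemLp.add hu hv
  | succ k ih =>
    refine ⟨hu.1.add hv.1, fun i => ?_⟩
    obtain ⟨g, h1, h2⟩ := hu.2 i
    obtain ⟨h, h3, h4⟩ := hv.2 i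
    exact ⟨g + h, h1.add hΩ h3, ih h2 h4⟩

theorem MemW.const_smul (c : ℝ) (hu : MemW Ω k u) : MemW Ω k (c • u) := by
  induction k generalizing u with
  | zero => exact MemLp.const_smul hu c
  | succ k ih =>
    refine ⟨hu.1.const_smul c, fun i => ?_⟩
    obtain ⟨g, h1, h2⟩ := hu.2 i
    exact ⟨c • g, h1.const_smul c, ih h2⟩

theorem MemW.sub (hΩ : IsOpen Ω) (hu : MemW Ω k u) (hv : MemW Ω k v) : MemW Ω k (u - v) := by
  simpa [sub_eq_add_neg] using hu.add hΩ (hv.const_smul (-1))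

theorem MemW.of_isTestFunction (hu : IsTestFunction Ω u) : MemW Ω k u := by
  induction k generalizing u with
  | zero => exact hu.memLp
  | succ k ih => exact ⟨hu.memLp, fun i => ⟨_, .of_isTestFunction hu i, ih (hu.pd i)⟩⟩

/-- Homogeneous functions belong to `W^{k,2}` of the ball when their derivatives of order `k` are
square integrable at the origin. -/
theorem MemW.of_isHomog {d : ℤ} (hm : 0 < m) (hu : IsHomog d u) (hd : 0 < 2 * (d - k) + m) :
    MemW (Metric.ball 0 1) k u := by
  induction k generalizing u d with
  | zero => exact hu.memLp_ball hm (by simpa using hd)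
  | succ k ih =>
    push_cast at hd
    refine ⟨hu.memLp_ball hm (by lia), fun i => ⟨_, .of_isHomog hu (by lia) i, ?_⟩⟩
    exact ih (hu.pd i) (by lia)

section Complete

variable [CompleteSpace F]

theorem MemW.weakPartial (hΩ : IsOpen Ω) (hu : MemW Ω (k + 1) u) (i : Fin m) :
    MemW Ω k (weakPartial Ω i u) :=
  let ⟨_, h1, h2⟩ := hu.2 i
  h2.congr (h1.weakPartial_ae_eq hΩ).symm

theorem weakPartial_add (hΩ : IsOpen Ω) (hu : MemW Ω (k + 1) u) (hv : MemW Ω (k + 1) v) :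
    weakPartial Ω i (u + v) =ᵐ[volume.restrict Ω] weakPartial Ω i u + weakPartial Ω i v :=
  ((hu.hasWeakPartial i).add hΩ (hv.hasWeakPartial i)).weakPartial_ae_eq hΩ

theorem weakPartial_const_smul (hΩ : IsOpen Ω) (c : ℝ) (hu : MemW Ω (k + 1) u) :
    weakPartial Ω i (c • u) =ᵐ[volume.restrict Ω] c • weakPartial Ω i u :=
  ((hu.hasWeakPartial i).const_smul c).weakPartial_ae_eq hΩ

end Complete

theorem sobolevNorm_congr (huv : u =ᵐ[volume.restrict Ω] v) :
    sobolevNorm Ω k u = sobolevNorm Ω k v := by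
  cases k with
  | zero => exact eLpNorm_congr_ae huv
  | succ k => simp only [sobolevNorm, weakPartial_congr huv, eLpNorm_congr_ae huv]

theorem eLpNorm_le_sobolevNorm : eLpNorm u 2 (volume.restrict Ω) ≤ sobolevNorm Ω k u := by
  cases k with
  | zero => exact le_rfl
  | succ k => exact le_self_add

theorem sobolevNorm_weakPartial_le (i : Fin m) :
    sobolevNorm Ω k (weakPartial Ω i u) ≤ sobolevNorm Ω (k + 1) u := by
  refine le_trans ?_ le_add_self
  exact Finset.single_le_sum (f := fun i => sobolevNorm Ω k (weakPartial Ω i u))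
    (fun _ _ => zero_le) (Finset.mem_univ i)

theorem sobolevNorm_add_le [CompleteSpace F] (hΩ : IsOpen Ω) (hu : MemW Ω k u)
    (hv : MemW Ω k v) : sobolevNorm Ω k (u + v) ≤ sobolevNorm Ω k u + sobolevNorm Ω k v := by
  induction k generalizing u v with
  | zero => exact eLpNorm_add_le hu.aestronglyMeasurable hv.aestronglyMeasurable (by norm_num)
  | succ k ih =>
    simp only [sobolevNorm]
    rw [add_add_add_comm, ← Finset.sum_add_distrib]
    refine add_le_add (eLpNorm_add_le hu.1.1 hv.1.1 (by norm_num)) (Finset.sum_le_sum fun i _ => ?_)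
    rw [sobolevNorm_congr (weakPartial_add hΩ hu hv)]
    exact ih (hu.weakPartial hΩ i) (hv.weakPartial hΩ i)

theorem sobolevNorm_const_smul [CompleteSpace F] (hΩ : IsOpen Ω) (c : ℝ) (hu : MemW Ω k u) :
    sobolevNorm Ω k (c • u) = ‖c‖ₑ * sobolevNorm Ω k u := by
  induction k generalizing u with
  | zero => exact eLpNorm_const_smul ..
  | succ k ih =>
    simp only [sobolevNorm]
    rw [mul_add, Finset.mul_sum, eLpNorm_const_smul]
    congr 1
    refine Finset.sum_congr rfl fun i _ => ?_
    rw [sobolevNorm_congr (weakPartial_const_smul hΩ c hu), ih (hu.weakPartial hΩ i)]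

end WeakDerivatives

/-! ### Bounded linear differential operators on Sobolev spaces and quadratic energies -/

section Operators

variable {m : ℕ} {F : Type*} [NormedAddCommGroup F] [InnerProductSpace ℝ F]
  {Ω : Set (Eucl m)} {j k : ℕ} {u v : Eucl m → F}

/-- `T` acts, for every `n`, as a bounded linear operator `W^{n+j,2}(Ω, F) → W^{n,2}(Ω, F)`. Since
functions are not identified here when they agree almost everywhere, linearity is an equality
almost everywhere. -/
structure IsSobolevOp (Ω : Set (Eucl m)) (j : ℕ) (T : (Eucl m → F) → Eucl m → F) : Prop where
  memW : ∀ n u, MemW Ω (n + j) u → MemW Ω n (T u)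
  congr : ∀ u v, u =ᵐ[volume.restrict Ω] v → T u =ᵐ[volume.restrict Ω] T v
  add : ∀ u v, MemW Ω j u → MemW Ω j v → T (u + v) =ᵐ[volume.restrict Ω] T u + T v
  const_smul : ∀ (c : ℝ) u, MemW Ω j u → T (c • u) =ᵐ[volume.restrict Ω] c • T u
  bound : ∀ n, ∃ C : NNReal, ∀ u, MemW Ω (n + j) u →
    sobolevNorm Ω n (T u) ≤ C * sobolevNorm Ω (n + j) u

namespace IsSobolevOp

variable {T S : (Eucl m → F) → Eucl m → F}

theorem id : IsSobolevOp Ω 0 (fun u : Eucl m → F => u) where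
  memW _ _ h := h
  congr _ _ h := h
  add _ _ _ _ := .rfl
  const_smul _ _ _ := .rfl
  bound n := ⟨1, fun u _ => by simp⟩

theorem memLp (hT : IsSobolevOp Ω j T) (hu : MemW Ω j u) : MemLp (T u) 2 (volume.restrict Ω) :=
  hT.memW 0 u (by rwa [zero_add])

theorem sub (hT : IsSobolevOp Ω j T) (hu : MemW Ω j u) (hv : MemW Ω j v) :
    T (u - v) =ᵐ[volume.restrict Ω] T u - T v := by
  rw [sub_eq_add_neg, ← neg_one_smul ℝ v]
  filter_upwards [hT.add u _ hu (hv.const_smul (-1)), hT.const_smul (-1) v hv] with x h1 h2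
  rw [h1, Pi.add_apply, h2, Pi.smul_apply, Pi.sub_apply, neg_one_smul, sub_eq_add_neg]

variable [CompleteSpace F]

protected theorem weakPartial (hΩ : IsOpen Ω) (i : Fin m) :
    IsSobolevOp Ω 1 (weakPartial (F := F) Ω i) where
  memW _ _ h := h.weakPartial hΩ i
  congr _ _ h := by rw [weakPartial_congr h]
  add _ _ hu hv := weakPartial_add hΩ hu hv
  const_smul c _ hu := weakPartial_const_smul hΩ c hu
  bound n := ⟨1, fun u _ => by simpa using sobolevNorm_weakPartial_le i⟩

omit [CompleteSpace F] in
theorem comp (hT : IsSobolevOp Ω j T) (hS : IsSobolevOp Ω k S) :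
    IsSobolevOp Ω (j + k) (fun u => T (S u)) where
  memW n u h := hT.memW n _ (hS.memW (n + j) u (by rwa [add_assoc]))
  congr u v h := hT.congr _ _ (hS.congr _ _ h)
  add u v hu hv := (hT.congr _ _ (hS.add u v (hu.mono le_add_self) (hv.mono le_add_self))).trans
    (hT.add _ _ (hS.memW j u hu) (hS.memW j v hv))
  const_smul c u hu := (hT.congr _ _ (hS.const_smul c u (hu.mono le_add_self))).trans
    (hT.const_smul c _ (hS.memW j u hu))
  bound n := by
    obtain ⟨C, hC⟩ := hT.bound n
    obtain ⟨D, hD⟩ := hS.bound (n + j)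
    refine ⟨C * D, fun u hu => ?_⟩
    rw [← add_assoc] at hu ⊢
    refine (hC _ (hS.memW _ u hu)).trans ?_
    rw [ENNReal.coe_mul, mul_assoc]
    gcongr
    exact hD u hu

theorem sum {ι : Type*} (hΩ : IsOpen Ω) (s : Finset ι) {T : ι → (Eucl m → F) → Eucl m → F}
    (hT : ∀ a ∈ s, IsSobolevOp Ω j (T a)) : IsSobolevOp Ω j (fun u => ∑ a ∈ s, T a u) := by
  classical
  induction s using Finset.induction_on with
  | empty =>
    simp only [Finset.sum_empty]
    have h0 : ∀ u : Eucl m → F, (0 : Eucl m → F) = (0 : ℝ) • u := fun u => (zero_smul ℝ u).symm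
    refine ⟨fun n u hu => ?_, fun _ _ _ => .rfl, fun _ _ _ _ => ?_, fun c _ _ => ?_,
      fun n => ⟨0, fun u hu => ?_⟩⟩
    · rw [h0 u]; exact (hu.mono le_self_add).const_smul 0
    · rw [add_zero]
    · rw [smul_zero]
    · rw [h0 u, sobolevNorm_const_smul hΩ 0 (hu.mono le_self_add)]
      simp
  | insert a s ha ih =>
    have hs := ih fun b hb => hT b (Finset.mem_insert_of_mem hb)
    have hTa := hT a (Finset.mem_insert_self a s)
    simp only [Finset.sum_insert ha]
    refine ⟨fun n u hu => (hTa.memW n u hu).add hΩ (hs.memW n u hu),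
      fun u v h => (hTa.congr u v h).add (hs.congr u v h), fun u v hu hv => ?_, fun c u hu => ?_,
      fun n => ?_⟩
    · refine ((hTa.add u v hu hv).add (hs.add u v hu hv)).trans (Eventually.of_forall fun x => ?_)
      simp only [Pi.add_apply]
      abel
    · refine ((hTa.const_smul c u hu).add (hs.const_smul c u hu)).trans ?_
      rw [smul_add]
    · obtain ⟨C, hC⟩ := hTa.bound n
      obtain ⟨D, hD⟩ := hs.bound n
      refine ⟨C + D, fun u hu => ?_⟩
      rw [ENNReal.coe_add, add_mul]
      exact (sobolevNorm_add_le hΩ (hTa.memW n u hu) (hs.memW n u hu)).trans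
        (add_le_add (hC u hu) (hD u hu))

protected theorem weakLaplacian (hΩ : IsOpen Ω) :
    IsSobolevOp Ω 2 (weakLaplacian (F := F) Ω) := by
  have h : weakLaplacian (F := F) Ω =
      fun u => ∑ i : Fin m, weakPartial Ω i (weakPartial Ω i u) := by
    ext u x
    simp [weakLaplacian]
  rw [h]
  exact sum hΩ _ fun i _ => (IsSobolevOp.weakPartial hΩ i).comp (.weakPartial hΩ i)

theorem iterate_weakLaplacian (hΩ : IsOpen Ω) (s : ℕ) :
    IsSobolevOp Ω (2 * s) ((weakLaplacian (F := F) Ω)^[s]) := by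
  induction s with
  | zero => exact id
  | succ s ih =>
    rw [Function.iterate_succ', mul_add, mul_one, add_comm]
    exact (IsSobolevOp.weakLaplacian hΩ).comp ih

omit [CompleteSpace F] in
/-- If `U` is a curve in `W^{k,2}(Ω, F)` with derivative `v` at `0` and `T` is a differential
operator of order `k`, then `‖T (U t)‖²` has derivative `2 ⟪T u, T v⟫` at `0`. -/
theorem hasDerivAt_integral_norm_sq (hΩ : IsOpen Ω) (hT : IsSobolevOp Ω k T) (hu : MemW Ω k u)
    (hv : MemW Ω k v) {U : ℝ → Eucl m → F} (hU0 : U 0 =ᵐ[volume.restrict Ω] u)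
    (hU : ∀ᶠ t in 𝓝 (0 : ℝ), MemW Ω k (U t))
    (hlim : Tendsto (fun t : ℝ => sobolevNorm Ω k (t⁻¹ • (U t - u) - v)) (𝓝[≠] 0) (𝓝 0)) :
    HasDerivAt (fun t => ∫ x in Ω, ‖T (U t) x‖ ^ 2) (2 * ∫ x in Ω, inner ℝ (T u x) (T v x)) 0 := by
  classical
  set μ := volume.restrict Ω
  let a : ℝ → Lp F 2 μ := fun t => if h : MemLp (T (U t)) 2 μ then h.toLp else 0
  have ha : ∀ {t}, MemW Ω k (U t) → ∃ h : MemLp (T (U t)) 2 μ, a t = h.toLp := fun h =>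
    ⟨hT.memLp h, dif_pos (hT.memLp h)⟩
  have ha0 : a 0 = (hT.memLp hu).toLp := by
    obtain ⟨h, h'⟩ := ha (hu.congr hU0.symm)
    rw [h', MemLp.toLp_eq_toLp_iff]
    exact hT.congr _ _ hU0
  have hder : HasDerivAt a (hT.memLp hv).toLp 0 := by
    rw [hasDerivAt_iff_tendsto_slope, tendsto_iff_edist_tendsto_0]
    obtain ⟨C, hC⟩ := hT.bound 0
    simp only [zero_add] at hC
    have hz : Tendsto (fun t : ℝ => (C : ENNReal) * sobolevNorm Ω k (t⁻¹ • (U t - u) - v))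
        (𝓝[≠] 0) (𝓝 0) := by
      simpa using ENNReal.Tendsto.const_mul hlim (Or.inr ENNReal.coe_ne_top)
    refine tendsto_of_tendsto_of_tendsto_of_le_of_le' tendsto_const_nhds hz
      (Eventually.of_forall fun _ => zero_le) ?_
    filter_upwards [hU.filter_mono nhdsWithin_le_nhds] with t ht
    obtain ⟨h1, h2⟩ := ha ht
    have h3 : slope a 0 t = ((h1.sub (hT.memLp hu)).const_smul t⁻¹).toLp := by
      rw [slope_def_module, h2, ha0, sub_zero, ← MemLp.toLp_sub, ← MemLp.toLp_const_smul]
    rw [h3, Lp.edist_toLp_toLp]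
    refine le_trans (le_of_eq ?_) (hC _ (((ht.sub hΩ hu).const_smul t⁻¹).sub hΩ hv))
    refine eLpNorm_congr_ae ?_
    filter_upwards [hT.sub ((ht.sub hΩ hu).const_smul t⁻¹) hv,
      hT.const_smul t⁻¹ _ (ht.sub hΩ hu), hT.sub ht hu] with x e1 e2 e3
    simp only [e1, e2, e3, Pi.sub_apply, Pi.smul_apply]
  have hsq := hder.norm_sq
  have hinner : ∀ {f g : Eucl m → F} (hf : MemLp f 2 μ) (hg : MemLp g 2 μ),
      inner ℝ hf.toLp hg.toLp = ∫ x, inner ℝ (f x) (g x) ∂μ := fun hf hg => by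
    rw [L2.inner_def]
    refine integral_congr_ae ?_
    filter_upwards [hf.coeFn_toLp, hg.coeFn_toLp] with x e1 e2
    rw [e1, e2]
  rw [ha0, hinner] at hsq
  refine hsq.congr_of_eventuallyEq ?_
  filter_upwards [hU] with t ht
  obtain ⟨h1, h2⟩ := ha ht
  rw [h2, ← real_inner_self_eq_norm_sq, hinner]
  simp only [real_inner_self_eq_norm_sq]

omit [CompleteSpace F] in
/-- The pairing `⟪f, T w⟫` is continuous in `w ∈ W^{k,2}`. -/
theorem tendsto_integral_inner (hΩ : IsOpen Ω) (hT : IsSobolevOp Ω k T) {f : Eucl m → F}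
    (hf : MemLp f 2 (volume.restrict Ω)) (hv : MemW Ω k v) {w : ℕ → Eucl m → F}
    (hw : ∀ n, MemW Ω k (w n))
    (hlim : Tendsto (fun n => sobolevNorm Ω k (v - w n)) atTop (𝓝 0)) :
    Tendsto (fun n => ∫ x in Ω, inner ℝ (f x) (T (w n) x)) atTop
      (𝓝 (∫ x in Ω, inner ℝ (f x) (T v x))) := by
  have hinner : ∀ {g : Eucl m → F} (hg : MemLp g 2 (volume.restrict Ω)),
      ∫ x in Ω, inner ℝ (f x) (g x) = inner ℝ hf.toLp hg.toLp := fun hg => by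
    rw [L2.inner_def]
    refine integral_congr_ae ?_
    filter_upwards [hf.coeFn_toLp, hg.coeFn_toLp] with x e1 e2
    rw [e1, e2]
  simp only [hinner (hT.memLp hv), fun n => hinner (hT.memLp (hw n))]
  refine Tendsto.inner tendsto_const_nhds (tendsto_iff_edist_tendsto_0.2 ?_)
  obtain ⟨C, hC⟩ := hT.bound 0
  simp only [zero_add] at hC
  have hz : Tendsto (fun n => (C : ENNReal) * sobolevNorm Ω k (v - w n)) atTop (𝓝 0) := by
    simpa using ENNReal.Tendsto.const_mul hlim (Or.inr ENNReal.coe_ne_top)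
  refine tendsto_of_tendsto_of_tendsto_of_le_of_le tendsto_const_nhds hz (fun _ => zero_le)
    fun n => ?_
  simp only
  rw [edist_comm, Lp.edist_toLp_toLp]
  refine le_trans (le_of_eq ?_) (hC _ (hv.sub hΩ (hw n)))
  exact eLpNorm_congr_ae (hT.sub hv (hw n)).symm

end IsSobolevOp

end Operators

/-! ### The Hardy inequality -/

section Hardy

variable {m : ℕ} {F : Type*} [NormedAddCommGroup F] [InnerProductSpace ℝ F]
  {Ω : Set (Eucl m)} {k : ℕ} {φ : Eucl m → F}

/-- The divergence of the radial field `r^b x`. -/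
theorem sum_pd_coord_mul_norm_zpow (b : ℤ) {x : Eucl m} (hx : x ≠ 0) :
    ∑ i, pd i (fun y : Eucl m => y i * ‖y‖ ^ b) x = (m + b) * ‖x‖ ^ b := by
  have hr : ‖x‖ ≠ 0 := norm_ne_zero_iff.2 hx
  have h1 : ∀ i, pd i (fun y : Eucl m => y i * ‖y‖ ^ b) x =
      ‖x‖ ^ b + b * ‖x‖ ^ (b - 2) * x i ^ 2 := fun i => by
    have h := pd_smul (i := i) (differentiableAt_coord i x)
      ((IsHomog.norm_zpow b).differentiableAt hx)
    simp only [smul_eq_mul] at h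
    rw [h, pd_norm_zpow b i hx, pd_coord, if_pos rfl]
    ring
  have hsq : ∑ i, x i ^ 2 = ‖x‖ ^ 2 := by
    rw [EuclideanSpace.norm_sq_eq]; simp
  have h4 : ‖x‖ ^ b = ‖x‖ ^ (b - 2) * ‖x‖ ^ 2 := by
    rw [← zpow_natCast ‖x‖ 2, ← zpow_add₀ hr]
    congr 1
    push_cast
    ring
  simp only [h1, Finset.sum_add_distrib, ← Finset.mul_sum, hsq, Finset.sum_const,
    Finset.card_univ, Fintype.card_fin, nsmul_eq_mul]
  rw [mul_assoc, ← h4]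
  ring

theorem IsTestFunction.norm_sq (hφ : IsTestFunction Ω φ) :
    IsTestFunction Ω (fun x => ‖φ x‖ ^ 2) := by
  have hs : Function.support (fun x => ‖φ x‖ ^ 2) = Function.support φ := by
    ext x; simp
  refine ⟨hφ.1.norm_sq ℝ, ?_, ?_⟩
  · rw [HasCompactSupport, tsupport, hs]; exact hφ.2.1
  · rw [tsupport, hs]; exact hφ.2.2

theorem norm_zpow_smul_sq {E F : Type*} [NormedAddCommGroup E] [NormedAddCommGroup F]
    [NormedSpace ℝ F] (b : ℤ) (x : E) (y : F) :
    ‖‖x‖ ^ b • y‖ ^ 2 = ‖y‖ ^ 2 * ‖x‖ ^ (2 * b) := by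
  rw [norm_smul, mul_pow, norm_zpow, norm_norm, ← zpow_natCast, ← zpow_mul, mul_comm, mul_comm b]
  rfl

/-- A weighted Hardy inequality, obtained by integrating `div (r^{-2a} x) = (m - 2a) r^{-2a}`
against `‖φ‖²`. -/
theorem hardy_sq (hm : 0 < m) {a : ℤ} (ha : 2 * a < m) (hφ : IsTestFunction Ω φ) :
    ∫ x, ‖‖x‖ ^ (-a) • φ x‖ ^ 2 ≤ 4 * m * ∑ i, ∫ x, ‖‖x‖ ^ (1 - a) • pd i φ x‖ ^ 2 := by
  have hmR : (0 : ℝ) < m := by exact_mod_cast hm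
  have hint : ∀ {b : ℤ} {ψ : Eucl m → F}, 0 < 2 * b + m → IsTestFunction Ω ψ →
      Integrable fun x => ‖‖x‖ ^ b • ψ x‖ ^ 2 := fun {b ψ} hb hψ => by
    simp only [norm_zpow_smul_sq]
    exact integrable_bilin (ContinuousLinearMap.mul ℝ ℝ) hψ.norm_sq.1.continuous hψ.norm_sq.2.1
      ((IsHomog.norm_zpow (2 * b)).locallyIntegrable hm hb)
  have hX : ∀ i, IsHomog (1 + (2 * -a)) (fun x : Eucl m => x i * ‖x‖ ^ (2 * -a)) := fun i =>
    (IsHomog.coord i).smul (IsHomog.norm_zpow _)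
  have hpart : ∀ i, ∫ x, pd i (fun x => ‖φ x‖ ^ 2) x * (x i * ‖x‖ ^ (2 * -a)) =
      -∫ x, ‖φ x‖ ^ 2 * pd i (fun x : Eucl m => x i * ‖x‖ ^ (2 * -a)) x := fun i =>
    (hX i).integral_bilin_pd (by lia) (ContinuousLinearMap.mul ℝ ℝ) hφ.norm_sq i
  have hi1 : ∀ i, Integrable fun x => pd i (fun x => ‖φ x‖ ^ 2) x * (x i * ‖x‖ ^ (2 * -a)) :=
    fun i => integrable_bilin (ContinuousLinearMap.mul ℝ ℝ) (hφ.norm_sq.pd i).1.continuous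
      (hφ.norm_sq.pd i).2.1 ((hX i).locallyIntegrable hm (by lia))
  have hi2 : ∀ i, Integrable fun x =>
      ‖φ x‖ ^ 2 * pd i (fun x : Eucl m => x i * ‖x‖ ^ (2 * -a)) x :=
    fun i => integrable_bilin (ContinuousLinearMap.mul ℝ ℝ) hφ.norm_sq.1.continuous
      hφ.norm_sq.2.1 (((hX i).pd i).locallyIntegrable hm (by lia))
  have hA := hint (b := -a) (by lia) hφ
  have hB : ∀ i, Integrable fun x => ‖‖x‖ ^ (1 - a) • pd i φ x‖ ^ 2 := fun i =>
    hint (by lia) (hφ.pd i)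
  have hi3 : ∀ i, Integrable fun x => -(pd i (fun x => ‖φ x‖ ^ 2) x * (x i * ‖x‖ ^ (2 * -a))) :=
    fun i => (hi1 i).neg
  have hi4 : ∀ i : Fin m, Integrable fun x => 1 / (2 * (m : ℝ)) * ‖‖x‖ ^ (-a) • φ x‖ ^ 2
      + 2 * m * ‖‖x‖ ^ (1 - a) • pd i φ x‖ ^ 2 := fun i =>
    (hA.const_mul _).add ((hB i).const_mul _)
  set A := ∫ x, ‖‖x‖ ^ (-a) • φ x‖ ^ 2 with hAdef
  have hA0 : 0 ≤ A := integral_nonneg fun x => by positivity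
  have h1 : ((m : ℝ) - 2 * a) * A =
      ∫ x, ∑ i, ‖φ x‖ ^ 2 * pd i (fun x : Eucl m => x i * ‖x‖ ^ (2 * -a)) x := by
    rw [hAdef, ← integral_const_mul]
    refine integral_congr_ae ((ae_ne_zero hm).mono fun x hx => ?_)
    simp only [norm_zpow_smul_sq, ← Finset.mul_sum, sum_pd_coord_mul_norm_zpow _ hx]
    push_cast
    ring
  have h2 : ∫ x, ∑ i, ‖φ x‖ ^ 2 * pd i (fun x : Eucl m => x i * ‖x‖ ^ (2 * -a)) x =
      ∫ x, ∑ i, -(pd i (fun x => ‖φ x‖ ^ 2) x * (x i * ‖x‖ ^ (2 * -a))) := by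
    rw [integral_finsetSum _ fun i _ => hi2 i, integral_finsetSum _ fun i _ => hi3 i]
    simp only [integral_neg, hpart, neg_neg]
  -- Young's inequality, with weights chosen so that the first term can be absorbed.
  have h3 : ∫ x, ∑ i, -(pd i (fun x => ‖φ x‖ ^ 2) x * (x i * ‖x‖ ^ (2 * -a))) ≤
      ∫ x, ∑ i : Fin m, (1 / (2 * m) * ‖‖x‖ ^ (-a) • φ x‖ ^ 2
        + 2 * m * ‖‖x‖ ^ (1 - a) • pd i φ x‖ ^ 2) := by
    refine integral_mono_ae (integrable_finsetSum _ fun i _ => hi3 i)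
      (integrable_finsetSum _ fun i _ => hi4 i)
      ((ae_ne_zero hm).mono fun x hx => Finset.sum_le_sum fun i _ => ?_)
    have hr : 0 < ‖x‖ := norm_pos_iff.2 hx
    have e1 : pd i (fun x => ‖φ x‖ ^ 2) x = 2 * inner ℝ (φ x) (pd i φ x) := by
      have := ((hφ.1.differentiable (by simp)) x).hasFDerivAt.norm_sq
      rw [pd, this.fderiv]
      simp [pd]
    have e2 : |x i| ≤ ‖x‖ := by simpa using PiLp.norm_apply_le x i
    have e3 : |inner ℝ (φ x) (pd i φ x)| ≤ ‖φ x‖ * ‖pd i φ x‖ := abs_real_inner_le_norm _ _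
    have e4 : ‖x‖ * ‖x‖ ^ (2 * -a) = ‖x‖ ^ (-a) * ‖x‖ ^ (1 - a) := by
      rw [← zpow_one_add₀ hr.ne', ← zpow_add₀ hr.ne']
      congr 1
      ring
    rw [e1]
    set p := ‖‖x‖ ^ (-a) • φ x‖ with hp
    set q := ‖‖x‖ ^ (1 - a) • pd i φ x‖ with hq
    rw [norm_smul, norm_zpow, norm_norm] at hp hq
    calc -(2 * inner ℝ (φ x) (pd i φ x) * (x i * ‖x‖ ^ (2 * -a)))
        ≤ |2 * inner ℝ (φ x) (pd i φ x) * (x i * ‖x‖ ^ (2 * -a))| := neg_le_abs _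
      _ = 2 * |inner ℝ (φ x) (pd i φ x)| * (|x i| * ‖x‖ ^ (2 * -a)) := by
        rw [abs_mul, abs_mul, abs_mul, abs_two, abs_of_pos (zpow_pos hr _)]
      _ ≤ 2 * (‖φ x‖ * ‖pd i φ x‖) * (‖x‖ * ‖x‖ ^ (2 * -a)) := by gcongr
      _ = 2 * p * q := by rw [e4, hp, hq]; ring
      _ ≤ 1 / (2 * m) * p ^ 2 + 2 * m * q ^ 2 := by
        have : 0 ≤ (2 * (m : ℝ))⁻¹ * (p - 2 * m * q) ^ 2 := by positivity
        have e5 : (2 * (m : ℝ))⁻¹ * (p - 2 * m * q) ^ 2 =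
            1 / (2 * m) * p ^ 2 + 2 * m * q ^ 2 - 2 * p * q := by
          field_simp
          ring
        linarith
  have h4 : ∫ x, ∑ i : Fin m, (1 / (2 * m) * ‖‖x‖ ^ (-a) • φ x‖ ^ 2
        + 2 * m * ‖‖x‖ ^ (1 - a) • pd i φ x‖ ^ 2) =
      1 / 2 * A + 2 * m * ∑ i, ∫ x, ‖‖x‖ ^ (1 - a) • pd i φ x‖ ^ 2 := by
    rw [integral_finsetSum _ fun i _ => hi4 i]
    simp only [integral_add (hA.const_mul _) ((hB _).const_mul _), integral_const_mul,
      Finset.sum_add_distrib, Finset.sum_const, Finset.card_univ, Fintype.card_fin, nsmul_eq_mul,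
      ← Finset.mul_sum]
    rw [← hAdef]
    field_simp
  have h5 : (1 : ℝ) ≤ m - 2 * a := by
    have : (2 * a + 1 : ℤ) ≤ m := ha
    have : (2 * a + 1 : ℝ) ≤ m := by exact_mod_cast this
    linarith
  nlinarith [mul_le_mul_of_nonneg_right h5 hA0]

theorem eLpNorm_two_eq {F : Type*} [NormedAddCommGroup F] {f : Eucl m → F}
    (hf : MemLp f 2 (volume.restrict Ω)) (h0 : ∀ x ∉ Ω, f x = 0) :
    eLpNorm f 2 (volume.restrict Ω) = ENNReal.ofReal (√(∫ x, ‖f x‖ ^ 2)) := by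
  rw [hf.eLpNorm_eq_integral_rpow_norm (by norm_num) (by norm_num),
    setIntegral_eq_integral_of_forall_compl_eq_zero fun x hx => by rw [h0 x hx]; simp,
    Real.sqrt_eq_rpow]
  simp

theorem IsTestFunction.memLp_norm_zpow_smul (hm : 0 < m) (hφ : IsTestFunction Ω φ) {b : ℤ}
    (hb : 0 < 2 * b + m) : MemLp (fun x => ‖x‖ ^ b • φ x) 2 (volume.restrict Ω) := by
  refine MemLp.restrict _ ((memLp_two_iff_integrable_sq_norm
    (((IsHomog.norm_zpow b).aestronglyMeasurable hm).smul
      hφ.1.continuous.aestronglyMeasurable)).2 ?_)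
  change Integrable fun x => ‖‖x‖ ^ b • φ x‖ ^ 2
  simp only [norm_zpow_smul_sq]
  exact integrable_bilin (ContinuousLinearMap.mul ℝ ℝ) hφ.norm_sq.1.continuous hφ.norm_sq.2.1
    ((IsHomog.norm_zpow (2 * b)).locallyIntegrable hm hb)

/-- The weighted Hardy inequality for the seminorms from which `sobolevNorm` is built. -/
theorem eLpNorm_hardy (hm : 0 < m) {a : ℤ} (ha : 2 * a < m) (hφ : IsTestFunction Ω φ) :
    eLpNorm (fun x => ‖x‖ ^ (-a) • φ x) 2 (volume.restrict Ω) ≤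
      (4 * m : NNReal) *
        ∑ i, eLpNorm (fun x => ‖x‖ ^ (1 - a) • pd i φ x) 2 (volume.restrict Ω) := by
  have hmR : (1 : ℝ) ≤ m := by exact_mod_cast hm
  rw [eLpNorm_two_eq (hφ.memLp_norm_zpow_smul hm (by lia))
      fun x hx => by rw [hφ.eq_zero hx, smul_zero],
    Finset.sum_congr rfl fun i _ => eLpNorm_two_eq ((hφ.pd i).memLp_norm_zpow_smul hm (by lia))
      fun x hx => by rw [(hφ.pd i).eq_zero hx, smul_zero],
    ← ENNReal.ofReal_sum_of_nonneg fun i _ => Real.sqrt_nonneg _,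
    ← ENNReal.ofReal_coe_nnreal, ← ENNReal.ofReal_mul (by positivity)]
  refine ENNReal.ofReal_le_ofReal ?_
  push_cast
  set B : Fin m → ℝ := fun i => ∫ x, ‖‖x‖ ^ (1 - a) • pd i φ x‖ ^ 2
  have hnn : ∀ i, 0 ≤ B i := fun i => integral_nonneg fun x => by positivity
  have h1 : ∑ i, B i ≤ (∑ i, √(B i)) ^ 2 := by
    have := Finset.sum_sq_le_sq_sum_of_nonneg (s := Finset.univ) (f := fun i => √(B i))
      fun i _ => Real.sqrt_nonneg _
    simpa only [Real.sq_sqrt (hnn _)] using this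
  have h2 := hardy_sq hm ha hφ
  refine Real.sqrt_le_iff.2 ⟨by positivity, h2.trans ?_⟩
  have h3 : 0 ≤ (∑ i, √(B i)) ^ 2 := sq_nonneg _
  calc 4 * (m : ℝ) * ∑ i, B i ≤ 4 * m * (∑ i, √(B i)) ^ 2 := by gcongr
    _ ≤ (4 * m) * (4 * m) * (∑ i, √(B i)) ^ 2 := by
      gcongr <;> linarith
    _ = _ := by ring

/-- The **Hardy inequality** `‖r⁻ᵏ φ‖ ≤ C ‖φ‖_{W^{k,2}}` for `2k < m`, by iterating its weighted
version. -/
theorem exists_hardy [CompleteSpace F] (hΩ : IsOpen Ω) (hk : 2 * k < m) :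
    ∃ C : NNReal, ∀ φ : Eucl m → F, IsTestFunction Ω φ →
      eLpNorm (fun x => ‖x‖ ^ (-(k : ℤ)) • φ x) 2 (volume.restrict Ω) ≤ C * sobolevNorm Ω k φ := by
  have hm : 0 < m := by lia
  induction k with
  | zero => exact ⟨1, fun φ _ => by simp [sobolevNorm]⟩
  | succ k ih =>
    obtain ⟨C, hC⟩ := ih (by lia)
    refine ⟨4 * m * C, fun φ hφ => (eLpNorm_hardy hm (by push_cast; lia) hφ).trans ?_⟩
    rw [show ((4 * m * C : NNReal) : ENNReal) = (4 * m : NNReal) * C from ENNReal.coe_mul _ _,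
      mul_assoc _ (C : ENNReal)]
    gcongr
    refine le_trans ?_ (mul_le_mul_right (le_add_self : _ ≤ sobolevNorm Ω (k + 1) φ) _)
    rw [Finset.mul_sum]
    refine Finset.sum_le_sum fun i _ => ?_
    have h1 : (1 : ℤ) - (k + 1 : ℕ) = -(k : ℤ) := by push_cast; ring
    rw [h1, sobolevNorm_congr ((HasWeakPartial.of_isTestFunction hφ i).weakPartial_ae_eq hΩ)]
    exact hC _ (hφ.pd i)

end Hardy

/-! ### The first variation of the extrinsic energies -/

section FirstVariation

variable {m : ℕ} {F : Type*} [NormedAddCommGroup F] [InnerProductSpace ℝ F]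
  {Ω : Set (Eucl m)} {k : ℕ} {u v : Eucl m → F} {U : ℝ → Eucl m → F}

/-- The velocity of a sphere-valued curve is pointwise orthogonal to its starting point. -/
theorem ae_inner_velocity_eq_zero (hu : MemW Ω k u)
    (hnorm : ∀ᵐ x ∂volume.restrict Ω, ‖u x‖ = 1)
    (hU : ∀ᶠ t in 𝓝 (0 : ℝ), MemWSphere Ω k (U t)) (hv : MemW Ω k v)
    (hlim : Tendsto (fun t : ℝ => sobolevNorm Ω k (t⁻¹ • (U t - u) - v)) (𝓝[≠] 0) (𝓝 0)) :
    ∀ᵐ x ∂volume.restrict Ω, inner ℝ (u x) (v x) = 0 := by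
  obtain ⟨t₀, ht₀⟩ := exists_seq_tendsto (𝓝[≠] (0 : ℝ))
  have hev : ∀ᶠ n in atTop, MemWSphere Ω k (U (t₀ n)) ∧ t₀ n ≠ 0 :=
    ht₀.eventually ((hU.filter_mono nhdsWithin_le_nhds).and self_mem_nhdsWithin)
  obtain ⟨N, hN⟩ := eventually_atTop.1 hev
  set t : ℕ → ℝ := fun n => t₀ (n + N)
  have ht : Tendsto t atTop (𝓝[≠] 0) := ht₀.comp (tendsto_add_atTop_nat N)
  have hS : ∀ n, MemWSphere Ω k (U (t n)) := fun n => (hN (n + N) le_add_self).1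
  have hne : ∀ n, t n ≠ 0 := fun n => (hN (n + N) le_add_self).2
  have hconv : TendstoInMeasure (volume.restrict Ω)
      (fun n => (t n)⁻¹ • (U (t n) - u)) atTop v := by
    refine tendstoInMeasure_of_tendsto_eLpNorm (p := 2) (by norm_num)
      (fun n => ((hS n).1.memLp.sub hu.memLp).1.const_smul _) hv.memLp.1 ?_
    exact tendsto_of_tendsto_of_tendsto_of_le_of_le tendsto_const_nhds (hlim.comp ht)
      (fun _ => zero_le) fun n => eLpNorm_le_sobolevNorm
  obtain ⟨ns, hns, hae⟩ := hconv.exists_seq_tendsto_ae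
  have hall : ∀ᵐ x ∂volume.restrict Ω, ∀ n, ‖U (t n) x‖ = 1 :=
    ae_all_iff.2 fun n => (hS n).2.mono fun x hx => by simpa using hx
  filter_upwards [hae, hall, hnorm] with x hx hUx hux
  set a : ℕ → F := fun n => ((t (ns n))⁻¹ • (U (t (ns n)) - u)) x
  have ht0 : Tendsto (fun n => t (ns n)) atTop (𝓝 0) :=
    (ht.mono_right nhdsWithin_le_nhds).comp hns.tendsto_atTop
  have h1 : ∀ n, 2 * inner ℝ (u x) (a n) = -(t (ns n) * ‖a n‖ ^ 2) := fun n => by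
    have h2 : U (t (ns n)) x = u x + t (ns n) • a n := by
      simp [a, smul_inv_smul₀ (hne _)]
    have h3 := norm_add_sq_real (u x) (t (ns n) • a n)
    rw [← h2, hUx, hux, inner_smul_right, norm_smul, mul_pow, Real.norm_eq_abs, sq_abs] at h3
    refine mul_left_cancel₀ (hne (ns n)) ?_
    linarith
  have h4 : Tendsto (fun n => 2 * inner ℝ (u x) (a n)) atTop (𝓝 (2 * inner ℝ (u x) (v x))) :=
    (tendsto_const_nhds.inner hx).const_mul 2
  have h5 : Tendsto (fun n => -(t (ns n) * ‖a n‖ ^ 2)) atTop (𝓝 (-(0 * ‖v x‖ ^ 2))) :=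
    (ht0.mul (hx.norm.pow 2)).neg
  simp only [h1] at h4
  have := tendsto_nhds_unique h4 h5
  simpa using this

theorem IsTestFunction.const_smul {φ : Eucl m → F} (hφ : IsTestFunction Ω φ) (c : ℝ) :
    IsTestFunction Ω (c • φ) :=
  ⟨hφ.1.const_smul c, hφ.2.1.smul_left (f := fun _ => c),
    (tsupport_smul_subset_right (fun _ => c) φ).trans hφ.2.2⟩

variable [CompleteSpace F]

/-- The velocity of a variation lies in the closure of the test functions. -/
theorem exists_isTestFunction_sobolevNorm_le (hΩ : IsOpen Ω)
    (hU : ∀ᶠ t in 𝓝 (0 : ℝ), MemWZero Ω k (U t - u)) (hv : MemW Ω k v)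
    (hlim : Tendsto (fun t : ℝ => sobolevNorm Ω k (t⁻¹ • (U t - u) - v)) (𝓝[≠] 0) (𝓝 0))
    {ε : ENNReal} (hε : 0 < ε) : ∃ φ, IsTestFunction Ω φ ∧ sobolevNorm Ω k (v - φ) ≤ ε := by
  have hε2 : 0 < ε / 2 := ENNReal.half_pos hε.ne'
  obtain ⟨t, ht1, ht2, ht3⟩ := ((hlim.eventually (gt_mem_nhds hε2)).and
    ((hU.filter_mono nhdsWithin_le_nhds).and self_mem_nhdsWithin)).exists
  have ht0 : t ≠ 0 := ht3
  have hte : ‖t‖ₑ ≠ 0 := by simpa using ht0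
  obtain ⟨φ, hφ, hlt⟩ := ht2.2 (‖t‖ₑ * (ε / 2)) (ENNReal.mul_pos hte hε2.ne')
  refine ⟨t⁻¹ • φ, hφ.const_smul _, ?_⟩
  have hd : v - t⁻¹ • φ =
      (-1 : ℝ) • (t⁻¹ • (U t - u) - v) + t⁻¹ • (U t - u - φ) := by
    ext x
    simp only [Pi.sub_apply, Pi.add_apply, Pi.smul_apply]
    module
  have hw1 : MemW Ω k (t⁻¹ • (U t - u) - v) := (ht2.1.const_smul _).sub hΩ hv
  have hw2 : MemW Ω k (U t - u - φ) := ht2.1.sub hΩ (.of_isTestFunction hφ)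
  rw [hd]
  refine (sobolevNorm_add_le hΩ (hw1.const_smul _) (hw2.const_smul _)).trans ?_
  rw [sobolevNorm_const_smul hΩ _ hw1, sobolevNorm_const_smul hΩ _ hw2, enorm_neg, enorm_one,
    one_mul, enorm_inv ht0]
  calc _ ≤ ε / 2 + ‖t‖ₑ⁻¹ * (‖t‖ₑ * (ε / 2)) := by gcongr
    _ = ε := by
      rw [← mul_assoc, ENNReal.inv_mul_cancel hte enorm_ne_top, one_mul, ENNReal.add_halves]

/-- If the energy pairing of `f` with test functions is represented by the density
`c r^{-2k} u`, then it vanishes on all `v` in the closure of the test functions that are pointwise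
orthogonal to `u`. The density is in general not square integrable; by the Hardy inequality
`r^{-k} φₙ` nevertheless converges in `L²` when the test functions `φₙ` converge to `v`. -/
theorem sum_integral_inner_eq_zero {ι : Type*} [Fintype ι] (hk : 2 * k < m)
    {T : ι → (Eucl m → F) → Eucl m → F} (hT : ∀ j, IsSobolevOp (Metric.ball 0 1) k (T j))
    {f : ι → Eucl m → F} (hf : ∀ j, MemLp (f j) 2 (volume.restrict (Metric.ball 0 1)))
    (hu : IsHomog 0 u) {c : ℝ}
    (hpair : ∀ φ, IsTestFunction (Metric.ball 0 1) φ →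
      ∑ j, ∫ x in Metric.ball 0 1, inner ℝ (f j x) (T j φ x) =
        c * ∫ x in Metric.ball 0 1, inner ℝ (‖x‖ ^ (-(k : ℤ)) • u x) (‖x‖ ^ (-(k : ℤ)) • φ x))
    (hv : MemW (Metric.ball 0 1) k v)
    (happ : ∀ ε : ENNReal, 0 < ε → ∃ φ, IsTestFunction (Metric.ball 0 1) φ ∧
      sobolevNorm (Metric.ball 0 1) k (v - φ) ≤ ε)
    (huv : ∀ᵐ x ∂volume.restrict (Metric.ball 0 1), inner ℝ (u x) (v x) = 0) :
    ∑ j, ∫ x in Metric.ball 0 1, inner ℝ (f j x) (T j v x) = 0 := by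
  have hm : 0 < m := by lia
  have hΩ : IsOpen (Metric.ball (0 : Eucl m) 1) := Metric.isOpen_ball
  set Ω := Metric.ball (0 : Eucl m) 1 with hΩdef
  set μ := volume.restrict Ω with hμ
  have hx0 : ∀ᵐ x ∂μ, x ≠ 0 := ae_restrict_of_ae (ae_ne_zero hm)
  have hxΩ : ∀ᵐ x ∂μ, x ∈ Ω := ae_restrict_mem hΩ.measurableSet
  obtain ⟨C, hC⟩ := exists_hardy (F := F) hΩ hk
  have hδ : ∀ n : ℕ, 0 < (n : ENNReal)⁻¹ := fun n => ENNReal.inv_pos.2 (ENNReal.natCast_ne_top n)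
  choose φ hφ hle using fun n : ℕ => happ _ (hδ n)
  have hφW : ∀ n, MemW Ω k (φ n) := fun n => .of_isTestFunction (hφ n)
  have hlim : Tendsto (fun n => sobolevNorm Ω k (v - φ n)) atTop (𝓝 0) :=
    tendsto_of_tendsto_of_tendsto_of_le_of_le tendsto_const_nhds
      ENNReal.tendsto_inv_nat_nhds_zero (fun _ => zero_le) hle
  have hψ : ∀ n, MemLp (fun x => ‖x‖ ^ (-(k : ℤ)) • φ n x) 2 μ := fun n =>
    (hφ n).memLp_norm_zpow_smul hm (by lia)
  have hsubtest : ∀ n p, IsTestFunction Ω (φ n - φ p) := fun n p =>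
    ⟨(hφ n).1.sub (hφ p).1, (hφ n).2.1.sub (hφ p).2.1,
      (tsupport_sub (φ n) (φ p)).trans (union_subset (hφ n).2.2 (hφ p).2.2)⟩
  have hcauchy : CauchySeq fun n => (hψ n).toLp := by
    refine EMetric.cauchySeq_iff_le_tendsto_0.2
      ⟨fun N => C * ((N : ENNReal)⁻¹ + (N : ENNReal)⁻¹), fun n p N hn hp => ?_, ?_⟩
    · rw [Lp.edist_toLp_toLp]
      have h1 : (fun x => ‖x‖ ^ (-(k : ℤ)) • φ n x) - (fun x => ‖x‖ ^ (-(k : ℤ)) • φ p x) =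
          fun x => ‖x‖ ^ (-(k : ℤ)) • (φ n - φ p) x := by
        ext x
        simp [smul_sub]
      rw [h1]
      refine (hC _ (hsubtest n p)).trans ?_
      beta_reduce
      gcongr
      have h2 : φ n - φ p = (-1 : ℝ) • (v - φ n) + (v - φ p) := by
        rw [neg_one_smul]
        abel
      rw [h2]
      refine (sobolevNorm_add_le hΩ ((hv.sub hΩ (hφW n)).const_smul _)
        (hv.sub hΩ (hφW p))).trans ?_
      rw [sobolevNorm_const_smul hΩ _ (hv.sub hΩ (hφW n)), enorm_neg, enorm_one, one_mul]
      refine add_le_add ((hle n).trans ?_) ((hle p).trans ?_) <;>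
      · refine ENNReal.inv_le_inv.2 ?_
        exact_mod_cast ‹_›
    · have h3 := ENNReal.tendsto_inv_nat_nhds_zero.add ENNReal.tendsto_inv_nat_nhds_zero
      simpa using ENNReal.Tendsto.const_mul h3 (Or.inr (ENNReal.coe_ne_top (r := C)))
  obtain ⟨g, hg⟩ := cauchySeq_tendsto_of_complete hcauchy
  have hgE : Tendsto (fun n => eLpNorm (fun x => ‖x‖ ^ (-(k : ℤ)) • φ n x - g x) 2 μ) atTop
      (𝓝 0) := by
    refine (tendsto_iff_edist_tendsto_0.1 hg).congr fun n => ?_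
    rw [Lp.edist_def]
    refine eLpNorm_congr_ae ?_
    filter_upwards [(hψ n).coeFn_toLp] with x hx
    simp only [Pi.sub_apply, hx]
  -- The `L²` limit `g` of `r⁻ᵏ φₙ` is `r⁻ᵏ v`.
  have hvg : v =ᵐ[μ] fun x => ‖x‖ ^ k • g x := by
    have hmeas : AEStronglyMeasurable (fun x => ‖x‖ ^ k • g x) μ :=
      (by fun_prop : Continuous fun x : Eucl m => ‖x‖ ^ k).aestronglyMeasurable.smul
        (Lp.aestronglyMeasurable g)
    have h0 : eLpNorm (v - fun x => ‖x‖ ^ k • g x) 2 μ = 0 := by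
      refine le_antisymm ?_ zero_le
      have hz := (tendsto_of_tendsto_of_tendsto_of_le_of_le tendsto_const_nhds hlim
        (fun _ => zero_le) fun n => eLpNorm_le_sobolevNorm).add hgE
      rw [add_zero] at hz
      refine ge_of_tendsto' hz fun n => ?_
      have h1 : v - (fun x => ‖x‖ ^ k • g x) = (v - φ n) + (φ n - fun x => ‖x‖ ^ k • g x) := by
        abel
      rw [h1]
      refine (eLpNorm_add_le (hv.memLp.1.sub (hφ n).memLp.1) ((hφ n).memLp.1.sub hmeas)
        (by norm_num)).trans (add_le_add le_rfl ?_)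
      refine eLpNorm_mono_ae ?_
      filter_upwards [hx0, hxΩ] with x hx hx1
      have hr : ‖x‖ ≠ 0 := norm_ne_zero_iff.2 hx
      have h2 : φ n x - ‖x‖ ^ k • g x = ‖x‖ ^ k • (‖x‖ ^ (-(k : ℤ)) • φ n x - g x) := by
        rw [smul_sub, smul_smul, zpow_neg, zpow_natCast, mul_inv_cancel₀ (pow_ne_zero k hr),
          one_smul]
      have h3 : ‖x‖ ≤ 1 := by
        have : ‖x‖ < 1 := by simpa [hΩdef] using hx1
        exact this.le
      simp only [Pi.sub_apply]
      rw [h2, norm_smul, norm_pow, norm_norm]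
      exact mul_le_of_le_one_left (norm_nonneg _) (pow_le_one₀ (norm_nonneg _) h3)
    rw [eLpNorm_eq_zero_iff (hv.memLp.1.sub hmeas) (by norm_num)] at h0
    filter_upwards [h0] with x hx using sub_eq_zero.1 hx
  have hUk : MemLp (fun x => ‖x‖ ^ (-(k : ℤ)) • u x) 2 μ :=
    ((IsHomog.norm_zpow (-(k : ℤ))).smul hu).memLp_ball hm (by lia)
  have hinner : ∀ {w : Eucl m → F} (hw : MemLp w 2 μ),
      ∫ x, inner ℝ (‖x‖ ^ (-(k : ℤ)) • u x) (w x) ∂μ = inner ℝ hUk.toLp hw.toLp := fun hw => by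
    rw [L2.inner_def]
    refine integral_congr_ae ?_
    filter_upwards [hUk.coeFn_toLp, hw.coeFn_toLp] with x e1 e2
    rw [e1, e2]
  have hL : Tendsto (fun n => ∑ j, ∫ x in Ω, inner ℝ (f j x) (T j (φ n) x)) atTop
      (𝓝 (∑ j, ∫ x in Ω, inner ℝ (f j x) (T j v x))) :=
    tendsto_finsetSum _ fun j _ => (hT j).tendsto_integral_inner hΩ (hf j) hv hφW hlim
  have hR : Tendsto (fun n => ∑ j, ∫ x in Ω, inner ℝ (f j x) (T j (φ n) x)) atTop
      (𝓝 (c * inner ℝ hUk.toLp g)) := by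
    refine ((tendsto_const_nhds.inner hg).const_mul c).congr fun n => ?_
    rw [hpair (φ n) (hφ n), hinner (hψ n)]
  rw [tendsto_nhds_unique hL hR, L2.inner_def]
  have hz : ∫ x, inner ℝ ((hUk.toLp : Lp F 2 μ) x) (g x) ∂μ = ∫ _, (0 : ℝ) ∂μ := by
    refine integral_congr_ae ?_
    filter_upwards [hUk.coeFn_toLp, hvg, huv, hx0] with x e1 e2 e3 hx
    have hr : ‖x‖ ^ k ≠ 0 := pow_ne_zero k (norm_ne_zero_iff.2 hx)
    rw [e2, inner_smul_right] at e3
    rw [e1, inner_smul_left, (mul_eq_zero.1 e3).resolve_left hr, mul_zero]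
  rw [hz, integral_zero, mul_zero]

end FirstVariation

/-! ### Polyharmonic integration by parts and criticality -/

section Polyharmonic

variable {m : ℕ} {F : Type*} [NormedAddCommGroup F] [InnerProductSpace ℝ F]
  {Ω : Set (Eucl m)} {k : ℕ} {d : ℤ} {f W φ : Eucl m → F}

theorem IsTestFunction.sum {ι : Type*} (s : Finset ι) {φ : ι → Eucl m → F}
    (hφ : ∀ j ∈ s, IsTestFunction Ω (φ j)) : IsTestFunction Ω (fun x => ∑ j ∈ s, φ j x) := by
  classical
  induction s using Finset.induction_on with
  | empty =>
    have h : tsupport (fun _ : Eucl m => (0 : F)) = ∅ := tsupport_eq_empty_iff.2 rfl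
    simp only [Finset.sum_empty]
    exact ⟨contDiff_const, by simp [HasCompactSupport, h], by simp [h]⟩
  | insert a s ha ih =>
    simp only [Finset.sum_insert ha]
    have h1 := hφ a (Finset.mem_insert_self a s)
    have h2 := ih fun j hj => hφ j (Finset.mem_insert_of_mem hj)
    exact ⟨h1.1.add h2.1, h1.2.1.add h2.2.1,
      (tsupport_add _ _).trans (union_subset h1.2.2 h2.2.2)⟩

theorem IsTestFunction.lap (hφ : IsTestFunction Ω φ) : IsTestFunction Ω (lap φ) :=
  .sum _ fun i _ => (hφ.pd i).pd i

theorem IsTestFunction.iterate_lap (hφ : IsTestFunction Ω φ) (s : ℕ) :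
    IsTestFunction Ω (ExtrinsicHarmonic.lap^[s] φ) := by
  induction s with
  | zero => exact hφ
  | succ s ih => rw [Function.iterate_succ_apply']; exact ih.lap

theorem IsHomog.iterate_lap (hf : IsHomog d f) (s : ℕ) :
    IsHomog (d - 2 * s) (ExtrinsicHarmonic.lap^[s] f) := by
  induction s with
  | zero => simpa using hf
  | succ s ih =>
    rw [Function.iterate_succ_apply']
    convert ih.lap using 1
    push_cast
    ring

theorem IsHomog.integral_inner_pd (hf : IsHomog d f) (hd : 1 < d + m) (hφ : IsTestFunction Ω φ)
    (i : Fin m) :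
    ∫ x, inner ℝ (pd i φ x) (f x) = -∫ x, inner ℝ (φ x) (ExtrinsicHarmonic.pd i f x) :=
  hf.integral_bilin_pd hd (innerSL ℝ) hφ i

theorem integrable_inner_isHomog (hm : 0 < m) (hf : IsHomog d f) (hd : 0 < d + m)
    (hφ : IsTestFunction Ω φ) : Integrable fun x => inner ℝ (φ x) (f x) :=
  integrable_bilin (innerSL ℝ) hφ.1.continuous hφ.2.1 (hf.locallyIntegrable hm hd)

theorem IsHomog.sum_integral_inner_pd_pd (hm : 0 < m) (hf : IsHomog d f) (hd : 2 < d + m)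
    (hφ : IsTestFunction Ω φ) :
    ∑ i, ∫ x, inner ℝ (pd i φ x) (ExtrinsicHarmonic.pd i f x) =
      -∫ x, inner ℝ (φ x) (lap f x) := by
  simp only [(hf.pd _).integral_inner_pd (show 1 < d - 1 + m by lia) hφ]
  rw [Finset.sum_neg_distrib, ← integral_finsetSum _ fun i _ =>
    integrable_inner_isHomog hm ((hf.pd i).pd i) (by lia) hφ]
  simp only [ExtrinsicHarmonic.lap, inner_sum]

theorem IsHomog.integral_inner_lap (hm : 0 < m) (hf : IsHomog d f) (hd : 2 < d + m)
    (hφ : IsTestFunction Ω φ) :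
    ∫ x, inner ℝ (ExtrinsicHarmonic.lap φ x) (f x) =
      ∫ x, inner ℝ (φ x) (ExtrinsicHarmonic.lap f x) := by
  rw [← neg_neg (∫ x, inner ℝ (φ x) (ExtrinsicHarmonic.lap f x)),
    ← hf.sum_integral_inner_pd_pd hm hd hφ, ← Finset.sum_neg_distrib]
  simp only [ExtrinsicHarmonic.lap, sum_inner]
  rw [integral_finsetSum _ fun i _ => integrable_inner_isHomog hm hf (by lia) ((hφ.pd i).pd i)]
  exact Finset.sum_congr rfl fun i _ => hf.integral_inner_pd (by lia) (hφ.pd i) i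

/-- Symmetry of the iterated Laplacian; the degree condition says that the iterated Laplacian of `f`
is still locally integrable at the origin. -/
theorem IsHomog.integral_inner_iterate_lap (hm : 0 < m) (hf : IsHomog d f) {s : ℕ}
    (hd : 0 < d - 2 * s + m) (hφ : IsTestFunction Ω φ) :
    ∫ x, inner ℝ (ExtrinsicHarmonic.lap^[s] φ x) (f x) =
      ∫ x, inner ℝ (φ x) (ExtrinsicHarmonic.lap^[s] f x) := by
  induction s generalizing φ with
  | zero => rfl
  | succ s ih =>
    push_cast at hd
    rw [Function.iterate_succ_apply, ih (by lia) hφ.lap,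
      (hf.iterate_lap s).integral_inner_lap hm (by lia) hφ, Function.iterate_succ_apply']

variable [CompleteSpace F]

theorem IsHomog.weakPartial_ae_eq (hΩ : IsOpen Ω) (hf : IsHomog d f) (hd : 1 < d + m)
    (i : Fin m) : weakPartial Ω i f =ᵐ[volume.restrict Ω] ExtrinsicHarmonic.pd i f :=
  (HasWeakPartial.of_isHomog hf hd i).weakPartial_ae_eq hΩ

theorem IsTestFunction.weakPartial_ae_eq (hΩ : IsOpen Ω) (hφ : IsTestFunction Ω φ)
    (i : Fin m) : weakPartial Ω i φ =ᵐ[volume.restrict Ω] ExtrinsicHarmonic.pd i φ :=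
  (HasWeakPartial.of_isTestFunction hφ i).weakPartial_ae_eq hΩ

omit [CompleteSpace F] in
theorem weakLaplacian_ae_eq_of_forall {g : Eucl m → F}
    (h : ∀ i, weakPartial Ω i g =ᵐ[volume.restrict Ω] pd i g)
    (h' : ∀ i, weakPartial Ω i (pd i g) =ᵐ[volume.restrict Ω] pd i (pd i g)) :
    weakLaplacian Ω g =ᵐ[volume.restrict Ω] lap g := by
  have : ∀ᵐ x ∂volume.restrict Ω, ∀ i, weakPartial Ω i (weakPartial Ω i g) x = pd i (pd i g) x :=
    ae_all_iff.2 fun i => by rw [weakPartial_congr (h i)]; exact h' i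
  filter_upwards [this] with x hx
  simp only [weakLaplacian, lap, hx]

theorem IsTestFunction.iterate_weakLaplacian_ae_eq (hΩ : IsOpen Ω) (hφ : IsTestFunction Ω φ)
    (s : ℕ) : (weakLaplacian Ω)^[s] φ =ᵐ[volume.restrict Ω] ExtrinsicHarmonic.lap^[s] φ := by
  induction s with
  | zero => rfl
  | succ s ih =>
    rw [Function.iterate_succ_apply', Function.iterate_succ_apply']
    have h := hφ.iterate_lap s
    exact ((IsSobolevOp.weakLaplacian hΩ).congr _ _ ih).trans (weakLaplacian_ae_eq_of_forall
      (fun i => h.weakPartial_ae_eq hΩ i) fun i => (h.pd i).weakPartial_ae_eq hΩ i)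

theorem IsHomog.iterate_weakLaplacian_ae_eq (hΩ : IsOpen Ω) (hf : IsHomog d f) {s : ℕ}
    (hd : 0 < d - 2 * s + m) :
    (weakLaplacian Ω)^[s] f =ᵐ[volume.restrict Ω] ExtrinsicHarmonic.lap^[s] f := by
  induction s with
  | zero => rfl
  | succ s ih =>
    push_cast at hd
    rw [Function.iterate_succ_apply', Function.iterate_succ_apply']
    have h := hf.iterate_lap s
    exact ((IsSobolevOp.weakLaplacian hΩ).congr _ _ (ih (by lia))).trans
      (weakLaplacian_ae_eq_of_forall (fun i => h.weakPartial_ae_eq hΩ (by lia) i)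
        fun i => (h.pd i).weakPartial_ae_eq hΩ (by lia) i)

omit [CompleteSpace F] in
theorem setIntegral_inner_eq {g ψ : Eucl m → F} (hφ : IsTestFunction Ω φ)
    (hf : g =ᵐ[volume.restrict Ω] f) (hψ : ψ =ᵐ[volume.restrict Ω] φ) :
    ∫ x in Ω, inner ℝ (g x) (ψ x) = ∫ x, inner ℝ (φ x) (f x) := by
  have h : ∫ x in Ω, inner ℝ (φ x) (f x) = ∫ x, inner ℝ (φ x) (f x) :=
    setIntegral_eq_integral_of_forall_compl_eq_zero
      fun x hx => by rw [hφ.eq_zero hx, inner_zero_left]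
  rw [← h]
  refine integral_congr_ae ?_
  filter_upwards [hf, hψ] with x h1 h2
  rw [h1, h2, real_inner_comm]

omit [CompleteSpace F] in
/-- If `f` is `c r^{-2k} W` off the origin, its pairing with test functions takes the symmetric
form that is controlled by the Hardy inequality. -/
theorem integral_inner_eq_const_mul (hm : 0 < m) (hφ : IsTestFunction Ω φ) {c : ℝ}
    (hf : EqOn f (fun x => c • ‖x‖ ^ (-2 * k : ℤ) • W x) {0}ᶜ) :
    ∫ x, inner ℝ (φ x) (f x) =
      c * ∫ x in Ω, inner ℝ (‖x‖ ^ (-(k : ℤ)) • W x) (‖x‖ ^ (-(k : ℤ)) • φ x) := by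
  rw [setIntegral_eq_integral_of_forall_compl_eq_zero
    fun x hx => by rw [hφ.eq_zero hx, smul_zero, inner_zero_right], ← integral_const_mul]
  refine integral_congr_ae ((ae_ne_zero hm).mono fun x hx => ?_)
  have hr : ‖x‖ ≠ 0 := norm_ne_zero_iff.2 hx
  have h1 : ‖x‖ ^ (-2 * k : ℤ) = ‖x‖ ^ (-(k : ℤ)) * ‖x‖ ^ (-(k : ℤ)) := by
    rw [← zpow_add₀ hr]
    congr 1
    ring
  simp only [hf hx, inner_smul_left, inner_smul_right, h1, real_inner_comm (W x),
    RCLike.conj_to_real]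
  ring

/-- A unit-length map that is homogeneous of degree zero and all of whose iterated Laplacians are
radial multiples of itself is extrinsic `k`-harmonic for `2k < m`. -/
theorem isExtrinsicHarmonic_of_iterate_lap (hk : 2 * k < m) (hW : IsHomog 0 W)
    (hlap : ∀ j : ℕ, ∃ c : ℝ,
      EqOn (lap^[j] W) (fun x => c • ‖x‖ ^ (-2 * j : ℤ) • W x) {0}ᶜ)
    (hnorm : ∀ x ≠ 0, ‖W x‖ = 1) : IsExtrinsicHarmonic (Metric.ball 0 1) k W := by
  have hm : 0 < m := by lia
  have hΩ : IsOpen (Metric.ball (0 : Eucl m) 1) := Metric.isOpen_ball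
  set Ω := Metric.ball (0 : Eucl m) 1 with hΩdef
  have hnorm' : ∀ᵐ x ∂volume.restrict Ω, ‖W x‖ = 1 :=
    ae_restrict_of_ae ((ae_ne_zero hm).mono hnorm)
  have hWk : MemW Ω k W := .of_isHomog hm hW (by lia)
  refine ⟨⟨hWk, hnorm'.mono fun x hx => by simpa using hx⟩, ?_⟩
  rintro U ⟨hU0, hU, v, hv, hlim⟩
  have hUW : ∀ᶠ t in 𝓝 (0 : ℝ), MemW Ω k (U t) := hU.mono fun t ht => ht.1.1
  have horth := ae_inner_velocity_eq_zero hWk hnorm' (hU.mono fun t ht => ht.1) hv hlim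
  have happ : ∀ ε : ENNReal, 0 < ε → ∃ φ, IsTestFunction Ω φ ∧ sobolevNorm Ω k (v - φ) ≤ ε :=
    fun ε hε => exists_isTestFunction_sobolevNorm_le hΩ (hU.mono fun t ht => ht.2) hv hlim hε
  -- It suffices to write the energy through finitely many operators of order `k` whose pairing
  -- with test functions is given by the density of the polyharmonic operator.
  have key : ∀ {n : ℕ} (T : Fin n → (Eucl m → F) → Eucl m → F), (∀ j, IsSobolevOp Ω k (T j)) →
      (∃ c : ℝ, ∀ φ, IsTestFunction Ω φ → ∑ j, ∫ x in Ω, inner ℝ (T j W x) (T j φ x) =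
        c * ∫ x in Ω, inner ℝ (‖x‖ ^ (-(k : ℤ)) • W x) (‖x‖ ^ (-(k : ℤ)) • φ x)) →
      (∀ w, MemW Ω k w → extrinsicEnergy Ω k w = ∑ j, 1 / 2 * ∫ x in Ω, ‖T j w x‖ ^ 2) →
      HasDerivAt (fun t => extrinsicEnergy Ω k (U t)) 0 0 := by
    rintro n T hT ⟨c, hc⟩ hE
    have h0 := sum_integral_inner_eq_zero hk hT (fun j => (hT j).memLp hWk) hW hc hv happ horth
    have h1 : HasDerivAt (fun t => ∑ j, 1 / 2 * ∫ x in Ω, ‖T j (U t) x‖ ^ 2)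
        (∑ j, 1 / 2 * (2 * ∫ x in Ω, inner ℝ (T j W x) (T j v x))) 0 :=
      HasDerivAt.fun_sum fun j _ =>
        ((hT j).hasDerivAt_integral_norm_sq hΩ hWk hv hU0 hUW hlim).const_mul _
    have h2 : ∑ j, 1 / 2 * (2 * ∫ x in Ω, inner ℝ (T j W x) (T j v x)) = 0 := by
      rw [← h0]
      refine Finset.sum_congr rfl fun j _ => ?_
      ring
    rw [h2] at h1
    exact h1.congr_of_eventuallyEq (hUW.mono fun t ht => hE _ ht)
  obtain ⟨s, hs | hs⟩ := k.even_or_odd'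
  · refine key (n := 1) (fun _ => (weakLaplacian Ω)^[s])
      (fun _ => by rw [hs]; exact .iterate_weakLaplacian hΩ s) ?_ fun w _ => ?_
    · -- All `s` Laplacians move from the test function to `W`.
      obtain ⟨c, hc⟩ := hlap (s + s)
      refine ⟨c, fun φ hφ => ?_⟩
      rw [Fin.sum_univ_one, setIntegral_inner_eq (hφ.iterate_lap s)
        (hW.iterate_weakLaplacian_ae_eq hΩ (by lia)) (hφ.iterate_weakLaplacian_ae_eq hΩ s),
        (hW.iterate_lap s).integral_inner_iterate_lap hm (by lia) hφ,
        ← Function.iterate_add_apply]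
      refine integral_inner_eq_const_mul hm hφ ?_
      rwa [show k = s + s by lia]
    · rw [extrinsicEnergy, if_pos (by simp [hs]), Fin.sum_univ_one, show k / 2 = s by lia]
  · have hT : ∀ i, IsSobolevOp Ω k
        (fun w : Eucl m → F => weakPartial Ω i ((weakLaplacian Ω)^[s] w)) := fun i => by
        rw [hs, add_comm]
        exact (IsSobolevOp.weakPartial hΩ i).comp (.iterate_weakLaplacian hΩ s)
    refine key (fun i w => weakPartial Ω i ((weakLaplacian Ω)^[s] w)) hT ?_ fun w hw => ?_
    · -- One derivative moves from the test function to `W`, then `s` Laplacians.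
      obtain ⟨c, hc⟩ := hlap (s + (s + 1))
      refine ⟨-c, fun φ hφ => ?_⟩
      have hWs := hW.iterate_lap s
      have hφs := hφ.iterate_lap s
      have h1 : ∀ i, ∫ x in Ω, inner ℝ (weakPartial Ω i ((weakLaplacian Ω)^[s] W) x)
          (weakPartial Ω i ((weakLaplacian Ω)^[s] φ) x) =
          ∫ x, inner ℝ (pd i (lap^[s] φ) x) (pd i (lap^[s] W) x) := fun i => by
        rw [weakPartial_congr (hW.iterate_weakLaplacian_ae_eq hΩ (by lia)),
          weakPartial_congr (hφ.iterate_weakLaplacian_ae_eq hΩ s)]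
        exact setIntegral_inner_eq (hφs.pd i) (hWs.weakPartial_ae_eq hΩ (by lia) i)
          (hφs.weakPartial_ae_eq hΩ i)
      simp only [h1]
      rw [hWs.sum_integral_inner_pd_pd hm (by lia) hφs, ← Function.iterate_succ_apply' lap,
        (hW.iterate_lap (s + 1)).integral_inner_iterate_lap hm (by push_cast; lia) hφ,
        ← Function.iterate_add_apply, neg_mul]
      congr 1
      refine integral_inner_eq_const_mul hm hφ ?_
      rwa [show k = s + (s + 1) by lia]
    · rw [extrinsicEnergy, if_neg (by simp [hs]), show k / 2 = s by lia, integral_finsetSum,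
        Finset.mul_sum]
      exact fun i _ => ((hT i).memLp hw).integrable_norm_pow (by norm_num)

end Polyharmonic

/-! ### Homogeneous maps with a harmonic multiple -/

section VectorCalculus

variable {m : ℕ} {F G : Type*} [NormedAddCommGroup F] [InnerProductSpace ℝ F]
  [NormedAddCommGroup G] [NormedSpace ℝ G] {d e : ℤ} {f W : Eucl m → F}

theorem pd_clm_comp {E : Type*} [NormedAddCommGroup E] [NormedSpace ℝ E] {f : Eucl m → E}
    (L : E →L[ℝ] G) {i : Fin m} {x : Eucl m} (hf : DifferentiableAt ℝ f x) :
    pd i (fun y => L (f y)) x = L (pd i f x) := by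
  have h : HasFDerivAt (fun y => L (f y)) (L ∘L fderiv ℝ f x) x :=
    L.hasFDerivAt.comp x hf.hasFDerivAt
  rw [pd, h.fderiv]
  rfl

theorem lap_clm_comp {E : Type*} [NormedAddCommGroup E] [NormedSpace ℝ E] {f : Eucl m → E}
    (L : E →L[ℝ] G) (hf : IsHomog d f) :
    EqOn (lap fun y => L (f y)) (fun y => L (lap f y)) {0}ᶜ := fun x hx => by
  simp only [lap, map_sum]
  refine Finset.sum_congr rfl fun i _ => ?_
  rw [pd_congr (fun y hy => pd_clm_comp L (hf.differentiableAt hy)) hx,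
    pd_clm_comp L ((hf.pd i).differentiableAt hx)]

theorem lap_const_smul (c : ℝ) (f : Eucl m → F) (x : Eucl m) :
    lap (fun y => c • f y) x = c • lap f x := by
  have h : ∀ i, pd i (fun y => c • f y) = fun y => c • pd i f y := fun i =>
    funext fun y => pd_const_smul c f y
  simp only [lap, h, pd_const_smul, Finset.smul_sum]

/-- If a radial multiple `r^e W` of a map `W` of degree zero is harmonic, then `Δ` acts on the
multiples `r^b W` by scalars and lowers the exponent by two. -/
theorem lap_norm_zpow_smul_of_harmonic (hW : IsHomog 0 W)
    (hV : EqOn (lap fun x => ‖x‖ ^ e • W x) 0 {0}ᶜ) (b : ℤ) :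
    EqOn (lap fun x => ‖x‖ ^ b • W x)
      (fun x => (((b : ℝ) - e) * (m + b + e - 2)) • ‖x‖ ^ (b - 2) • W x) {0}ᶜ := fun x hx => by
  have hz : ∀ {y : Eucl m}, y ≠ 0 → ∀ c : ℤ, ‖y‖ ^ (c - e) • ‖y‖ ^ e • W y = ‖y‖ ^ c • W y :=
    fun {y} hy c => by
      rw [smul_smul, ← zpow_add₀ (norm_ne_zero_iff.2 hy), sub_add_cancel]
  have h1 := ((IsHomog.norm_zpow e).smul hW).lap_norm_zpow_smul hV (b - e) hx
  rw [lap_congr (fun y hy => (hz hy b).symm) hx, h1]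
  simp only
  rw [show b - e - 2 = (b - 2) - e by ring, hz hx]
  push_cast
  ring_nf

/-- Iterating `lap_norm_zpow_smul_of_harmonic` from `b = 0`: `Δʲ W = c r^{-2j} W`. -/
theorem exists_iterate_lap_eq (hW : IsHomog 0 W)
    (hV : EqOn (lap fun x => ‖x‖ ^ e • W x) 0 {0}ᶜ) (j : ℕ) :
    ∃ c : ℝ, EqOn (lap^[j] W) (fun x => c • ‖x‖ ^ (-2 * j : ℤ) • W x) {0}ᶜ := by
  induction j with
  | zero => exact ⟨1, fun x _ => by simp⟩
  | succ j ih =>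
    obtain ⟨c, hc⟩ := ih
    refine ⟨c * (((-2 * j : ℤ) - e) * (m + (-2 * j : ℤ) + e - 2)), fun x hx => ?_⟩
    rw [Function.iterate_succ_apply', lap_congr hc hx, lap_const_smul,
      lap_norm_zpow_smul_of_harmonic hW hV _ hx, smul_smul]
    rw [show (-2 * (j : ℤ) - 2) = -2 * ((j + 1 : ℕ) : ℤ) by push_cast; ring]

/-- A unit-length map with `ΔW = -c r⁻² W` has energy density `|∇W|² = c r⁻²`. -/
theorem sum_norm_sq_pd (hW : IsHomog d W) (hnorm : ∀ x ≠ 0, ‖W x‖ = 1) {c : ℝ}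
    (hlap : EqOn (lap W) (fun x => -c • ‖x‖ ^ (-2 : ℤ) • W x) {0}ᶜ) {x : Eucl m} (hx : x ≠ 0) :
    ∑ i, ‖pd i W x‖ ^ 2 = c * ‖x‖ ^ (-2 : ℤ) := by
  have h1 : ∀ i, EqOn (fun y => inner ℝ (W y) (pd i W y)) (fun _ => (0 : ℝ)) {0}ᶜ :=
    fun i y hy => by
      have h2 := pd_bilin (i := i) (innerSL ℝ) (hW.differentiableAt hy) (hW.differentiableAt hy)
      have h3 : EqOn (fun z => innerSL ℝ (W z) (W z)) (fun _ => (1 : ℝ)) {0}ᶜ := fun z hz => by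
        simp only [innerSL_apply_apply, real_inner_self_eq_norm_sq, hnorm z hz, one_pow]
      rw [pd_congr h3 hy, innerSL_apply_apply, innerSL_apply_apply,
        real_inner_comm (W y) (pd i W y)] at h2
      have h4 : pd i (fun _ : Eucl m => (1 : ℝ)) y = 0 := by simp [pd]
      rw [h4] at h2
      linarith
  have h5 : ∀ i, ‖pd i W x‖ ^ 2 = -inner ℝ (W x) (pd i (pd i W) x) := fun i => by
    have h2 : pd i (fun y => inner ℝ (W y) (pd i W y)) x =
        inner ℝ (W x) (pd i (pd i W) x) + inner ℝ (pd i W x) (pd i W x) :=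
      pd_bilin (innerSL ℝ) (hW.differentiableAt hx) ((hW.pd i).differentiableAt hx)
    have h4 : pd i (fun _ : Eucl m => (0 : ℝ)) x = 0 := by simp [pd]
    have h6 := pd_congr (i := i) (h1 i) hx
    rw [h6, h4, real_inner_self_eq_norm_sq] at h2
    linarith
  have h6 : ∑ i, inner ℝ (W x) (pd i (pd i W) x) = inner ℝ (W x) (lap W x) := by
    simp only [lap, inner_sum]
  rw [Finset.sum_congr rfl fun i _ => h5 i, Finset.sum_neg_distrib, h6, hlap hx]
  simp only [inner_smul_right, real_inner_self_eq_norm_sq, hnorm x hx]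
  ring

end VectorCalculus

/-! ### Analytic properties of the generalized equator map -/

section EquatorMap

variable {m : ℕ}

theorem radialProj_one_eq (x : Eucl m) (I : Fin 1 → Fin m) :
    radialProj m 1 x I = ‖x‖ ^ (-1 : ℤ) • x (I 0) := by
  rw [radialProj, zpow_neg_one, smul_eq_mul, div_eq_inv_mul]

theorem radialProj_succ_eq (ℓ : ℕ) (x : Eucl m) (I : Fin (ℓ + 2) → Fin m) :
    radialProj m (ℓ + 2) x I = radialConst (ℓ + 2) m *
      (x (I (Fin.last (ℓ + 1))) / ‖x‖ * radialProj m (ℓ + 1) x (Fin.init I) -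
        1 / ((ℓ : ℝ) + m - 1) * ‖x‖ *
          pd (I (Fin.last (ℓ + 1))) (fun z => radialProj m (ℓ + 1) z (Fin.init I)) x) := by
  rw [radialProj, pd]
  push_cast
  rw [show (ℓ : ℝ) + 2 + m - 3 = ℓ + m - 1 by ring]

theorem isHomog_radialProj (ℓ : ℕ) (I : Fin (ℓ + 1) → Fin m) :
    IsHomog 0 (fun x => radialProj m (ℓ + 1) x I) := by
  induction ℓ with
  | zero =>
    exact ((IsHomog.norm_zpow (-1)).smul (IsHomog.coord (I 0))).congr
      fun x _ => radialProj_one_eq x I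
  | succ ℓ ih =>
    have h1 := ((IsHomog.norm_zpow (-1)).smul (IsHomog.coord (I (Fin.last (ℓ + 1))))).smul
      (ih (Fin.init I))
    have h2 := ((IsHomog.norm_zpow 1).smul ((ih (Fin.init I)).pd
      (I (Fin.last (ℓ + 1))))).const_smul (-(1 / ((ℓ : ℝ) + m - 1)))
    have h3 := (h1.add h2).const_smul (radialConst (ℓ + 2) m)
    refine h3.congr fun x _ => ?_
    rw [radialProj_succ_eq]
    simp only [smul_eq_mul, zpow_neg_one, zpow_one]
    ring

/-- The components of the generalized radial projection are, up to a power of `r`, harmonic: the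
recursion amounts to differentiating `r^{1-m-ℓ} u^{(ℓ+1)}`, the Kelvin transform of a harmonic
polynomial of degree `ℓ + 1`. -/
theorem lap_norm_zpow_smul_radialProj (hm : 2 ≤ m) (ℓ : ℕ) (I : Fin (ℓ + 1) → Fin m) :
    EqOn (lap fun x => ‖x‖ ^ (1 - m - ℓ : ℤ) • radialProj m (ℓ + 1) x I) 0 {0}ᶜ := by
  induction ℓ with
  | zero =>
    intro x hx
    have hz : EqOn (fun x : Eucl m => ‖x‖ ^ (1 - m - (0 : ℕ) : ℤ) • radialProj m 1 x I)
        (fun x => ‖x‖ ^ (-m : ℤ) • x (I 0)) {0}ᶜ := fun y hy => by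
      simp only [radialProj_one_eq, smul_smul]
      rw [← zpow_add₀ (norm_ne_zero_iff.2 hy)]
      congr 2
      push_cast
      ring
    have hlin : EqOn (lap fun x : Eucl m => x (I 0)) 0 {0}ᶜ := fun y _ => by
      have : ∀ i, pd i (fun y : Eucl m => y (I 0)) = fun _ => if I 0 = i then 1 else 0 :=
        fun i => funext fun y => pd_coord i (I 0) y
      simp [lap, this, pd]
    rw [lap_congr hz hx, (IsHomog.coord (I 0)).lap_norm_zpow_smul hlin (-m) hx]
    push_cast
    simp
  | succ ℓ ih =>
    intro x hx
    set i := I (Fin.last (ℓ + 1)) with hi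
    set u : Eucl m → ℝ := fun x => radialProj m (ℓ + 1) x (Fin.init I) with hu
    have hu0 : IsHomog 0 u := isHomog_radialProj ℓ (Fin.init I)
    set e : ℤ := 1 - m - ℓ with he
    have hV : IsHomog (e + 0) (fun x => ‖x‖ ^ e • u x) := (IsHomog.norm_zpow e).smul hu0
    have he0 : (e : ℝ) ≠ 0 := by
      have : e ≠ 0 := by lia
      exact_mod_cast this
    have heR : (e : ℝ) = -(ℓ + m - 1) := by rw [he]; push_cast; ring
    have hz : EqOn (fun x : Eucl m => ‖x‖ ^ (1 - m - (ℓ + 1 : ℕ) : ℤ) • radialProj m (ℓ + 2) x I)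
        (fun x => (radialConst (ℓ + 2) m / e) • pd i (fun x => ‖x‖ ^ e • u x) x) {0}ᶜ :=
      fun y hy => by
        have hr : ‖y‖ ≠ 0 := norm_ne_zero_iff.2 hy
        simp only
        rw [pd_smul ((IsHomog.norm_zpow e).differentiableAt hy) (hu0.differentiableAt hy),
          pd_norm_zpow e i hy, radialProj_succ_eq]
        have e1 : ‖y‖ ^ (1 - m - (ℓ + 1 : ℕ) : ℤ) = ‖y‖ ^ (e - 2) * ‖y‖ := by
          rw [← zpow_add_one₀ hr]
          congr 1
          push_cast
          ring
        have e2 : ‖y‖ ^ e = ‖y‖ ^ (e - 2) * ‖y‖ * ‖y‖ := by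
          rw [← zpow_add_one₀ hr, ← zpow_add_one₀ hr]
          congr 1
          ring
        have e3 : (ℓ : ℝ) + m - 1 = -e := by rw [heR]; ring
        rw [e1, e2, e3]
        simp only [smul_eq_mul, ← hi, ← hu]
        field_simp
        ring
    rw [lap_congr hz hx, lap_const_smul, hV.lap_pd i hx,
      pd_congr (ih (Fin.init I)) hx]
    simp [pd]

/-- The isometric inclusion of families of reals into `ℝ^{m^ℓ} × ℝ`, as a continuous linear map on
the product space `(Fin ℓ → Fin m) → ℝ`. -/
noncomputable def targetInclusion (m ℓ : ℕ) : ((Fin ℓ → Fin m) → ℝ) →L[ℝ] Target m ℓ :=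
  (WithLp.prodContinuousLinearEquiv 2 ℝ (EuclideanSpace ℝ (Fin ℓ → Fin m)) ℝ).symm ∘L
    ContinuousLinearMap.inl ℝ (EuclideanSpace ℝ (Fin ℓ → Fin m)) ℝ ∘L
      (EuclideanSpace.equiv (Fin ℓ → Fin m) ℝ).symm

theorem equatorMap_eq (m ℓ : ℕ) :
    equatorMap m ℓ = fun x => targetInclusion m ℓ (radialProj m ℓ x) := rfl

theorem norm_targetInclusion_sq {ℓ : ℕ} (a : (Fin ℓ → Fin m) → ℝ) :
    ‖targetInclusion m ℓ a‖ ^ 2 = ∑ I, a I ^ 2 := by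
  have h : targetInclusion m ℓ a = WithLp.toLp 2 (WithLp.toLp 2 a, 0) := rfl
  rw [h, WithLp.prod_norm_sq_eq_of_L2]
  simp [EuclideanSpace.norm_sq_eq]

theorem isHomog_radialProj_pi (ℓ : ℕ) : IsHomog 0 (radialProj m (ℓ + 1)) where
  contDiffOn := contDiffOn_pi.2 fun I => (isHomog_radialProj ℓ I).contDiffOn
  map_smul t ht x hx := funext fun I => (isHomog_radialProj ℓ I).map_smul t ht x hx

theorem isHomog_equatorMap (ℓ : ℕ) : IsHomog 0 (equatorMap m (ℓ + 1)) where
  contDiffOn := (targetInclusion m (ℓ + 1)).contDiff.comp_contDiffOn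
    (isHomog_radialProj_pi ℓ).contDiffOn
  map_smul t ht x hx := by
    rw [equatorMap_eq]
    simp only [(isHomog_radialProj_pi ℓ).map_smul t ht x hx, map_smul]

theorem pd_radialProj_apply (ℓ : ℕ) (i : Fin m) (I : Fin (ℓ + 1) → Fin m) {x : Eucl m}
    (hx : x ≠ 0) :
    pd i (radialProj m (ℓ + 1)) x I = pd i (fun y => radialProj m (ℓ + 1) y I) x :=
  (pd_clm_comp (ContinuousLinearMap.proj (R := ℝ) (φ := fun _ : Fin (ℓ + 1) → Fin m => ℝ) I)
    ((isHomog_radialProj_pi ℓ).differentiableAt hx)).symm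

theorem norm_sq_pd_equatorMap (ℓ : ℕ) (i : Fin m) {x : Eucl m} (hx : x ≠ 0) :
    ‖pd i (equatorMap m (ℓ + 1)) x‖ ^ 2 =
      ∑ I, pd i (fun y => radialProj m (ℓ + 1) y I) x ^ 2 := by
  rw [equatorMap_eq, pd_clm_comp _ ((isHomog_radialProj_pi ℓ).differentiableAt hx),
    norm_targetInclusion_sq]
  simp only [pd_radialProj_apply ℓ i _ hx]

theorem lap_norm_zpow_smul_equatorMap (hm : 2 ≤ m) (ℓ : ℕ) :
    EqOn (lap fun x => ‖x‖ ^ (1 - m - ℓ : ℤ) • equatorMap m (ℓ + 1) x) 0 {0}ᶜ := fun x hx => by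
  have hg : IsHomog (1 - m - ℓ + 0 : ℤ)
      (fun x => ‖x‖ ^ (1 - m - ℓ : ℤ) • radialProj m (ℓ + 1) x) :=
    (IsHomog.norm_zpow _).smul (isHomog_radialProj_pi ℓ)
  have h1 : (fun x => ‖x‖ ^ (1 - m - ℓ : ℤ) • equatorMap m (ℓ + 1) x) =
      fun x => targetInclusion m (ℓ + 1) (‖x‖ ^ (1 - m - ℓ : ℤ) • radialProj m (ℓ + 1) x) := by
    ext1 x
    rw [map_smul, equatorMap_eq]
  have h2 : lap (fun x => ‖x‖ ^ (1 - m - ℓ : ℤ) • radialProj m (ℓ + 1) x) x = 0 := by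
    ext I
    exact (lap_clm_comp (ContinuousLinearMap.proj (R := ℝ)
      (φ := fun _ : Fin (ℓ + 1) → Fin m => ℝ) I) hg hx).symm.trans
      (lap_norm_zpow_smul_radialProj hm ℓ I hx)
  rw [h1, lap_clm_comp _ hg hx]
  beta_reduce
  rw [h2, map_zero, Pi.zero_apply]

/-- The generalized equator map is an eigenmap: `Δu = -(ℓ + 1)(ℓ + m - 1) r⁻² u`, the index of the
map being `ℓ + 1`. -/
theorem lap_equatorMap (hm : 2 ≤ m) (ℓ : ℕ) :
    EqOn (lap (equatorMap m (ℓ + 1)))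
      (fun x => -(((ℓ : ℝ) + 1) * (m + ℓ - 1)) • ‖x‖ ^ (-2 : ℤ) • equatorMap m (ℓ + 1) x) {0}ᶜ :=
  fun x hx => by
    have h := lap_norm_zpow_smul_of_harmonic (isHomog_equatorMap ℓ)
      (lap_norm_zpow_smul_equatorMap hm ℓ) 0 hx
    simp only [zpow_zero, one_smul, zero_sub] at h
    rw [h]
    congr 1
    push_cast
    ring

theorem sum_sq_coord_div_norm {x : Eucl m} (hx : x ≠ 0) : ∑ i, (x i / ‖x‖) ^ 2 = 1 := by
  have hr : ‖x‖ ^ 2 ≠ 0 := pow_ne_zero 2 (norm_ne_zero_iff.2 hx)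
  simp only [div_pow, ← Finset.sum_div]
  rw [div_eq_one_iff_eq hr, EuclideanSpace.norm_sq_eq]
  simp

theorem radialConst_sq (hm : 2 ≤ m) (ℓ : ℕ) :
    radialConst (ℓ + 2) m ^ 2 = ((ℓ : ℝ) + m - 1) / (2 * ℓ + m) := by
  have hmR : (2 : ℝ) ≤ m := by exact_mod_cast hm
  have hℓ : (0 : ℝ) ≤ ℓ := ℓ.cast_nonneg
  have h : (((ℓ + 2 : ℕ) : ℝ) + m - 3) / (2 * ((ℓ + 2 : ℕ) : ℝ) + m - 4) =
      ((ℓ : ℝ) + m - 1) / (2 * ℓ + m) := by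
    push_cast
    congr 1 <;> ring
  rw [radialConst, h, Real.sq_sqrt]
  exact div_nonneg (by linarith) (by linarith)

theorem norm_equatorMap_sq (ℓ : ℕ) (x : Eucl m) :
    ‖equatorMap m ℓ x‖ ^ 2 = ∑ I, radialProj m ℓ x I ^ 2 := by
  rw [equatorMap_eq, norm_targetInclusion_sq]

/-- The generalized radial projection has unit length. In the inductive step the mixed terms vanish
by Euler's identity, and the energy density of the previous map is known from its Laplacian. -/
theorem norm_equatorMap (hm : 2 ≤ m) (ℓ : ℕ) (x : Eucl m) (hx : x ≠ 0) :
    ‖equatorMap m (ℓ + 1) x‖ = 1 := by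
  induction ℓ generalizing x with
  | zero =>
    refine (sq_eq_sq₀ (norm_nonneg _) zero_le_one).1 ?_
    rw [norm_equatorMap_sq, one_pow, ← sum_sq_coord_div_norm hx,
      ← (Equiv.funUnique (Fin 1) (Fin m)).sum_comp]
    rfl
  | succ ℓ ih =>
    refine (sq_eq_sq₀ (norm_nonneg _) zero_le_one).1 ?_
    have hr : ‖x‖ ≠ 0 := norm_ne_zero_iff.2 hx
    have hmR : (2 : ℝ) ≤ m := by exact_mod_cast hm
    have hℓ : (0 : ℝ) ≤ ℓ := ℓ.cast_nonneg
    set κ : ℝ := 1 / ((ℓ : ℝ) + m - 1) with hκ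
    set C := radialConst (ℓ + 2) m with hC
    set u : (Fin (ℓ + 1) → Fin m) → Eucl m → ℝ := fun J y => radialProj m (ℓ + 1) y J with hu
    have h1 : ∑ J, u J x ^ 2 = 1 := by
      rw [hu, ← norm_equatorMap_sq, ih x hx, one_pow]
    have h2 : ∑ i, ∑ J, pd i (u J) x ^ 2 = ((ℓ : ℝ) + 1) * (m + ℓ - 1) * ‖x‖ ^ (-2 : ℤ) := by
      rw [← sum_norm_sq_pd (isHomog_equatorMap ℓ) ih (lap_equatorMap hm ℓ) hx]
      exact Finset.sum_congr rfl fun i _ => (norm_sq_pd_equatorMap ℓ i hx).symm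
    have h3 : ∀ J, ∑ i, x i * pd i (u J) x = 0 := fun J => by
      simpa using (isHomog_radialProj ℓ J).euler hx
    have h4 : ∀ (i : Fin m) (J : Fin (ℓ + 1) → Fin m),
        radialProj m (ℓ + 2) x (Fin.snoc (α := fun _ => Fin m) J i) ^ 2 =
        C ^ 2 * ((x i / ‖x‖) ^ 2 * u J x ^ 2 - 2 * κ * u J x * (x i * pd i (u J) x)
          + κ ^ 2 * ‖x‖ ^ 2 * pd i (u J) x ^ 2) := fun i J => by
      rw [radialProj_succ_eq, Fin.snoc_last, Fin.init_snoc]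
      simp only [← hκ, ← hC, hu]
      field_simp
      ring
    have h5 : ∑ i, ∑ J, u J x * (x i * pd i (u J) x) = 0 := by
      rw [Finset.sum_comm]
      simp only [← Finset.mul_sum, h3, mul_zero, Finset.sum_const_zero]
    have h6 : ∑ i, ∑ J, (x i / ‖x‖) ^ 2 * u J x ^ 2 = 1 := by
      simp only [← Finset.mul_sum, h1, mul_one]
      exact sum_sq_coord_div_norm hx
    have h7 : ∑ i, ∑ J, 2 * κ * u J x * (x i * pd i (u J) x) = 0 := by
      simp only [mul_assoc (2 * κ), ← Finset.mul_sum, h5, mul_zero]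
    have h8 : ∑ i, ∑ J, κ ^ 2 * ‖x‖ ^ 2 * pd i (u J) x ^ 2 =
        κ ^ 2 * (((ℓ : ℝ) + 1) * (m + ℓ - 1)) := by
      simp only [← Finset.mul_sum, h2]
      rw [zpow_neg]
      norm_cast
      field_simp
    rw [norm_equatorMap_sq, one_pow, ← (Fin.snocEquiv fun _ => Fin m).sum_comp,
      Fintype.sum_prod_type]
    change ∑ i, ∑ J, radialProj m (ℓ + 2) x (Fin.snoc (α := fun _ => Fin m) J i) ^ 2 = 1
    calc ∑ i, ∑ J, radialProj m (ℓ + 2) x (Fin.snoc (α := fun _ => Fin m) J i) ^ 2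
        = C ^ 2 * (1 - 0 + κ ^ 2 * (((ℓ : ℝ) + 1) * (m + ℓ - 1))) := by
          simp only [h4, ← Finset.mul_sum]
          simp only [Finset.sum_add_distrib, Finset.sum_sub_distrib, h6, h7, h8]
      _ = 1 := by
          have h9 : (0 : ℝ) < ℓ + m - 1 := by linarith
          have h10 : (0 : ℝ) < 2 * ℓ + m := by linarith
          rw [hC, radialConst_sq hm, hκ, show (m : ℝ) + ℓ - 1 = ℓ + m - 1 by ring]
          field_simp
          ring

end EquatorMap

/-! ### Failure of Sobolev regularity in low dimension -/

section LowDimension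

variable {m : ℕ} {F : Type*} [NormedAddCommGroup F] [InnerProductSpace ℝ F]
  {d : ℤ} {f : Eucl m → F}

/-- If `f` is homogeneous of degree `d` with `2d + m ≤ 0`, the scaling `x ↦ x / 2` shows that the
half ball carries at least as much of `∫ |f|²` as the ball, so `f` vanishes on the annulus. -/
theorem IsHomog.eq_zero_of_memLp (hf : IsHomog d f) (hm : 0 < m) (hd : 2 * d + m ≤ 0)
    (h : MemLp f 2 (volume.restrict (Metric.ball (0 : Eucl m) 1))) {x : Eucl m} (hx : x ≠ 0) :
    f x = 0 := by
  set g : Eucl m → ℝ := fun x => ‖f x‖ ^ 2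
  have hg : IntegrableOn g (Metric.ball 0 1) := h.integrable_norm_pow (by norm_num)
  have hsub : Metric.ball (0 : Eucl m) (1 / 2) ⊆ Metric.ball 0 1 :=
    Metric.ball_subset_ball (by norm_num)
  have hA0 : 0 ≤ ∫ x in Metric.ball 0 1, g x := integral_nonneg fun x => by positivity
  have hscale : ∫ x in Metric.ball 0 1, g x ≤ ∫ x in Metric.ball 0 (1 / 2), g x := by
    have h1 := Measure.setIntegral_comp_smul_of_pos (volume : Measure (Eucl m)) g
      (Metric.ball 0 1) (show (0 : ℝ) < 1 / 2 by norm_num)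
    have h2 : ∫ x in Metric.ball 0 1, g ((1 / 2 : ℝ) • x) =
        (1 / 2 : ℝ) ^ (2 * d) * ∫ x in Metric.ball 0 1, g x := by
      rw [← integral_const_mul]
      refine integral_congr_ae (ae_restrict_of_ae ((ae_ne_zero hm).mono fun x hx => ?_))
      simp only [g]
      rw [hf.map_smul _ (by norm_num) x hx, norm_smul, mul_pow, _root_.norm_zpow, ← zpow_natCast,
        ← zpow_mul, mul_comm d]
      norm_num
    rw [h2, smul_unitBall_of_pos (by norm_num), finrank_euclideanSpace, Fintype.card_fin,
      smul_eq_mul, eq_inv_mul_iff_mul_eq₀ (by positivity), ← mul_assoc, ← zpow_natCast,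
      ← zpow_add₀ (by norm_num)] at h1
    rw [← h1]
    have h3 : (1 : ℝ) ≤ (1 / 2) ^ ((m : ℤ) + 2 * d) := by
      rw [one_div, inv_zpow']
      exact one_le_zpow₀ (by norm_num) (by lia)
    exact le_mul_of_one_le_left hA0 h3
  have hae : g =ᵐ[volume.restrict (Metric.ball 0 1 \ Metric.ball 0 (1 / 2))] 0 := by
    have h1 := setIntegral_sdiff (μ := volume) (f := g) Metric.isOpen_ball.measurableSet hg hsub
    refine (setIntegral_eq_zero_iff_of_nonneg_ae (Eventually.of_forall fun x => by positivity)
      (hg.mono_set sdiff_subset)).1 (le_antisymm (by linarith) ?_)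
    exact integral_nonneg fun x => by positivity
  set A : Set (Eucl m) := {x | 1 / 2 < ‖x‖ ∧ ‖x‖ < 1}
  have hAo : IsOpen A :=
    (isOpen_lt continuous_const continuous_norm).inter (isOpen_lt continuous_norm continuous_const)
  have hA1 : A ⊆ Metric.ball 0 1 \ Metric.ball 0 (1 / 2) := fun x hx => by
    simp only [Set.mem_sdiff, mem_ball_zero_iff, not_lt]
    exact ⟨hx.2, hx.1.le⟩
  have hA2 : A ⊆ {0}ᶜ := fun x hx h => by
    have := hx.1
    rw [mem_singleton_iff.1 h, norm_zero] at this
    norm_num at this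
  have hEq : EqOn g 0 A := Measure.eqOn_open_of_ae_eq
    (ae_restrict_of_ae_restrict_of_subset hA1 hae) hAo
    ((hf.continuousOn.mono hA2).norm.pow 2) continuousOn_const
  have hr : 0 < ‖x‖ := norm_pos_iff.2 hx
  have hc : 0 < 3 / 4 * ‖x‖⁻¹ := by positivity
  have hy : (3 / 4 * ‖x‖⁻¹) • x ∈ A := by
    have : ‖(3 / 4 * ‖x‖⁻¹) • x‖ = 3 / 4 := by
      rw [norm_smul, Real.norm_of_nonneg hc.le]
      field_simp
    simp only [A, mem_ofPred_eq, this]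
    norm_num
  have h5 : ‖f ((3 / 4 * ‖x‖⁻¹) • x)‖ ^ 2 = 0 := hEq hy
  rw [hf.map_smul _ hc x hx] at h5
  have h6 := norm_eq_zero.1 (pow_eq_zero_iff two_ne_zero |>.1 h5)
  exact (smul_eq_zero.1 h6).resolve_left (zpow_ne_zero _ hc.ne')

theorem HasWeakPartial.mono {Ω Ω' : Set (Eucl m)} {i : Fin m} {u g : Eucl m → F} (h : Ω' ⊆ Ω)
    (H : HasWeakPartial Ω i u g) : HasWeakPartial Ω' i u g := by
  refine ⟨H.1.mono_set h, H.2.1.mono_set h, fun φ hφ => ?_⟩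
  have hφ' : IsTestFunction Ω φ := ⟨hφ.1, hφ.2.1, hφ.2.2.trans h⟩
  have key := H.integral_pd hφ'
  change ∫ x in Ω', pd i φ x • u x = _
  rw [setIntegral_eq_integral_of_forall_compl_eq_zero
      fun x hx => by rw [(hφ'.pd i).eq_zero hx, zero_smul],
    setIntegral_eq_integral_of_forall_compl_eq_zero
      fun x hx => by rw [hφ'.eq_zero hx, zero_smul]] at key
  rw [setIntegral_eq_integral_of_forall_compl_eq_zero
      fun x hx => by rw [(hφ.pd i).eq_zero hx, zero_smul],
    setIntegral_eq_integral_of_forall_compl_eq_zero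
      fun x hx => by rw [hφ.eq_zero hx, zero_smul], key]

/-- Away from the origin the classical derivative of a homogeneous function is a weak one, whatever
the degree. -/
theorem IsHomog.hasWeakPartial_punctured (hf : IsHomog d f) {Ω : Set (Eucl m)} (hΩ : IsOpen Ω)
    (h0 : Ω ⊆ {0}ᶜ) (i : Fin m) : HasWeakPartial Ω i f (ExtrinsicHarmonic.pd i f) := by
  have hl : ∀ {d : ℤ} {f : Eucl m → F}, IsHomog d f → LocallyIntegrableOn f Ω := fun hf =>
    (hf.continuousOn.mono h0).locallyIntegrableOn hΩ.measurableSet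
  have hint : ∀ {d : ℤ} {f : Eucl m → F} {φ : Eucl m → ℝ}, IsHomog d f → IsTestFunction Ω φ →
      Integrable fun x => φ x • f x := fun hf hφ => by
    refine (integrableOn_iff_integrable_of_support_subset fun x hx => ?_).1
      (hφ.integrable_smul hΩ (hl hf))
    by_contra h
    exact hx (by simp [hφ.eq_zero h])
  refine ⟨hl hf, hl (hf.pd i), fun φ hφ => ?_⟩
  change ∫ x in Ω, ExtrinsicHarmonic.pd i φ x • f x = _
  rw [setIntegral_eq_integral_of_forall_compl_eq_zero
      fun x hx => by rw [(hφ.pd i).eq_zero hx, zero_smul],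
    setIntegral_eq_integral_of_forall_compl_eq_zero
      fun x hx => by rw [hφ.eq_zero hx, zero_smul], eq_neg_iff_add_eq_zero, add_comm,
      ← eq_neg_iff_add_eq_zero]
  exact integral_smul_fderiv_eq_neg_fderiv_smul_of_integrable (hint hf (hφ.pd i))
    (hint (hf.pd i) hφ) (hint hf hφ) (fun x _ => hφ.1.differentiable (by simp) x)
    (fun x hx => hf.differentiableAt (h0 (hφ.2.2 hx)))

variable [CompleteSpace F]

/-- A weak derivative of a homogeneous function, if there is one, is the classical derivative,
whatever the degree. -/
theorem IsHomog.ae_eq_of_hasWeakPartial (hf : IsHomog d f) {Ω : Set (Eucl m)} (hΩ : IsOpen Ω)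
    {i : Fin m} {g : Eucl m → F} (hg : HasWeakPartial Ω i f g) :
    g =ᵐ[volume.restrict Ω] ExtrinsicHarmonic.pd i f := by
  have hΩ' : IsOpen (Ω ∩ {0}ᶜ) := hΩ.inter isOpen_compl_singleton
  have h1 := (hg.mono inter_subset_left).ae_eq hΩ'
    (hf.hasWeakPartial_punctured hΩ' inter_subset_right i)
  rw [EventuallyEq, ae_restrict_iff' hΩ'.measurableSet] at h1
  rw [EventuallyEq, ae_restrict_iff' hΩ.measurableSet]
  filter_upwards [h1, ae_ne_zero i.pos] with x hx hx0 hxΩ using hx ⟨hxΩ, hx0⟩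

theorem IsHomog.memW_pd (hf : IsHomog d f) {k : ℕ} (h : MemW (Metric.ball 0 1) (k + 1) f)
    (i : Fin m) : MemW (Metric.ball 0 1) k (ExtrinsicHarmonic.pd i f) :=
  let ⟨_, h1, h2⟩ := h.2 i
  h2.congr (hf.ae_eq_of_hasWeakPartial Metric.isOpen_ball h1)

/-- A homogeneous function of negative degree in `W^{k,2}` of the ball vanishes when its derivatives
of order `k` would not be square integrable: these vanish by scaling, and Euler's identity then
gives the vanishing of the derivatives of lower order. -/
theorem IsHomog.eq_zero_of_memW (hf : IsHomog d f) (hm : 0 < m) (hd0 : d < 0) {k : ℕ}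
    (hd : 2 * (d - k) + m ≤ 0) (h : MemW (Metric.ball (0 : Eucl m) 1) k f) {x : Eucl m}
    (hx : x ≠ 0) : f x = 0 := by
  induction k generalizing d f with
  | zero => exact hf.eq_zero_of_memLp hm (by simpa using hd) h hx
  | succ k ih =>
    push_cast at hd
    have h1 : ∀ i, ExtrinsicHarmonic.pd i f x = 0 := fun i =>
      ih (hf.pd i) (by lia) (by lia) (hf.memW_pd h i)
    have h2 := hf.euler hx
    simp only [h1, smul_zero, Finset.sum_const_zero] at h2
    refine (smul_eq_zero.1 h2.symm).resolve_left ?_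
    exact_mod_cast hd0.ne

end LowDimension

/-! ### The generalized equator map in low dimension, and its criticality -/

section EquatorMap

variable {m : ℕ}

/-- The derivatives of the map are homogeneous of degree `-1`, so `IsHomog.eq_zero_of_memW` applies
to them; but they do not vanish, as the energy density is a positive multiple of `r⁻²`. -/
theorem not_memW_equatorMap (hm : 2 ≤ m) {k : ℕ} (hk : 1 ≤ k) (hkm : m ≤ 2 * k) (ℓ : ℕ) :
    ¬ MemW (Metric.ball 0 1) k (equatorMap m (ℓ + 1)) := fun h => by
  obtain ⟨k, rfl⟩ := Nat.exists_eq_add_of_le' hk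
  have hm0 : 0 < m := by lia
  set x : Eucl m := EuclideanSpace.single ⟨0, hm0⟩ 1 with hxdef
  have hx1 : ‖x‖ = 1 := by simp [hxdef]
  have hx : x ≠ 0 := norm_ne_zero_iff.1 (by rw [hx1]; exact one_ne_zero)
  have h1 : ∀ i, pd i (equatorMap m (ℓ + 1)) x = 0 := fun i =>
    ((isHomog_equatorMap ℓ).pd i).eq_zero_of_memW hm0 (by lia) (by lia)
      ((isHomog_equatorMap ℓ).memW_pd h i) hx
  have h2 := sum_norm_sq_pd (isHomog_equatorMap ℓ) (norm_equatorMap hm ℓ) (lap_equatorMap hm ℓ) hx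
  simp only [h1, norm_zero, hx1, one_zpow, mul_one, ne_eq, OfNat.ofNat_ne_zero, not_false_eq_true,
    zero_pow, Finset.sum_const_zero] at h2
  have hmR : (2 : ℝ) ≤ m := by exact_mod_cast hm
  have hℓ : (0 : ℝ) ≤ ℓ := ℓ.cast_nonneg
  have : 0 < ((ℓ : ℝ) + 1) * (m + ℓ - 1) := mul_pos (by linarith) (by linarith)
  linarith

theorem isTestFunction_one_sub_cutoff :
    IsTestFunction (Metric.ball 0 1) (fun x : Eucl m => 1 - cutoff 4 x) := by
  have hcl : IsClosed {x : Eucl m | 4 * ‖x‖ ^ 2 ≤ 2} :=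
    isClosed_le (by fun_prop) continuous_const
  have hsub : {x : Eucl m | 4 * ‖x‖ ^ 2 ≤ 2} ⊆ Metric.ball 0 1 := fun x hx => by
    rw [mem_ball_zero_iff]
    have : 4 * ‖x‖ ^ 2 ≤ 2 := hx
    nlinarith [norm_nonneg x]
  have hts : tsupport (fun x : Eucl m => 1 - cutoff 4 x) ⊆ {x : Eucl m | 4 * ‖x‖ ^ 2 ≤ 2} := by
    refine closure_minimal (fun x hx => ?_) hcl
    by_contra h
    simp only [mem_ofPred_eq, not_le] at h
    exact hx (sub_eq_zero.2 (Real.smoothTransition.one_of_one_le (by linarith)).symm)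
  refine ⟨contDiff_const.sub (contDiff_cutoff 4), ?_, hts.trans hsub⟩
  exact (isCompact_closedBall (0 : Eucl m) 1).of_isClosed_subset (isClosed_tsupport _)
    ((hts.trans hsub).trans Metric.ball_subset_closedBall)

/-- On the line the map is the sign function: its weak derivative would vanish off the origin,
hence almost everywhere, which a radially decreasing test function excludes. -/
theorem not_memW_equatorMap_one {k : ℕ} (hk : 1 ≤ k) :
    ¬ MemW (Metric.ball 0 1) k (equatorMap 1 1) := fun h => by
  have hW := isHomog_equatorMap (m := 1) 0
  obtain ⟨g, hg, -⟩ := (h.mono hk).2 0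
  have hpd : ∀ x ≠ 0, pd 0 (equatorMap 1 1) x = 0 := fun x hx => by
    have h1 := hW.euler hx
    simp only [Finset.univ_unique, Fin.default_eq_zero, Finset.sum_singleton, Int.cast_zero,
      zero_smul] at h1
    refine (smul_eq_zero.1 h1).resolve_left fun h0 => hx ?_
    ext j
    rw [Subsingleton.elim j 0, h0]
    rfl
  have hg0 : g =ᵐ[volume.restrict (Metric.ball 0 1)] 0 :=
    (hW.ae_eq_of_hasWeakPartial Metric.isOpen_ball hg).trans
      (ae_restrict_of_ae ((ae_ne_zero one_pos).mono hpd))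
  set φ : Eucl 1 → ℝ := fun x => 1 - cutoff 4 x with hφdef
  have hφ : IsTestFunction (Metric.ball 0 1) φ := isTestFunction_one_sub_cutoff
  set D : Eucl 1 → ℝ := fun x => deriv Real.smoothTransition (4 * ‖x‖ ^ 2 - 1)
  have hφpd : ∀ x, pd 0 φ x = -(D x * (4 * (2 * x 0))) := fun x => by
    rw [← pd_cutoff, hφdef]
    simp [pd, fderiv_const_sub]
  have hD : ∀ x, 0 ≤ D x := fun x => Real.smoothTransition.monotone.deriv_nonneg
  set s : Eucl 1 → ℝ := fun x => x 0 / ‖x‖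
  have hs : IsHomog 0 s := by
    have h := (IsHomog.norm_zpow (m := 1) (-1)).smul (IsHomog.coord 0)
    rw [neg_add_cancel] at h
    exact h.congr fun x _ => by simp [s, div_eq_inv_mul]
  have hWs : ∀ x, equatorMap 1 1 x = s x • targetInclusion 1 1 fun _ => 1 := fun x => by
    rw [equatorMap_eq, ← map_smul]
    refine congrArg (targetInclusion 1 1) (funext fun I => ?_)
    simp [radialProj, s, Subsingleton.elim (I 0) 0]
  have key := hg.integral_pd hφ
  have hzero : ∫ x in Metric.ball 0 1, φ x • g x = 0 := by
    rw [integral_congr_ae (g := fun _ => 0) (hg0.mono fun x hx => by simp [hx])]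
    simp
  have hw : targetInclusion 1 1 (fun _ => 1) ≠ 0 := fun h0 => by
    have := norm_targetInclusion_sq (m := 1) (ℓ := 1) fun _ => 1
    rw [h0] at this
    simp at this
  simp only [hzero, neg_zero, hWs, smul_smul] at key
  rw [integral_smul_const] at key
  have key2 := (smul_eq_zero.1 key).resolve_right hw
  have hint : Integrable (fun x => pd 0 φ x * s x) (volume.restrict (Metric.ball 0 1)) :=
    (hφ.pd 0).integrable_smul Metric.isOpen_ball
      ((hs.locallyIntegrable one_pos (by norm_num)).locallyIntegrableOn _)
  have hsign : ∀ x, 0 ≤ -(pd 0 φ x * s x) := fun x => by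
    have : -(pd 0 φ x * s x) = 8 * D x * (x 0 ^ 2 / ‖x‖) := by
      rw [hφpd]
      ring
    rw [this]
    have := hD x
    positivity
  have hae : (fun x => -(pd 0 φ x * s x)) =ᵐ[volume.restrict (Metric.ball 0 1)] 0 := by
    refine (setIntegral_eq_zero_iff_of_nonneg_ae (Eventually.of_forall hsign) hint.neg).1 ?_
    rw [integral_neg, key2, neg_zero]
  have hsne : ∀ x : Eucl 1, x ≠ 0 → s x ≠ 0 := fun x hx => by
    refine div_ne_zero (fun h0 => hx ?_) (norm_ne_zero_iff.2 hx)
    ext j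
    rw [Subsingleton.elim j 0, h0]
    rfl
  have hφ0 : EqOn (pd 0 φ) 0 (Metric.ball 0 1) := by
    refine Measure.eqOn_open_of_ae_eq (μ := volume) ?_ Metric.isOpen_ball
      (hφ.pd 0).1.continuous.continuousOn continuousOn_const
    filter_upwards [hae, ae_restrict_of_ae (ae_ne_zero one_pos)] with x hx hx0
    exact (mul_eq_zero.1 (neg_eq_zero.1 hx)).resolve_right (hsne x hx0)
  have hfd : ∀ x, fderiv ℝ φ x = 0 := fun x => by
    have h1 : pd 0 φ x = 0 := by
      by_cases hx : x ∈ Metric.ball (0 : Eucl 1) 1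
      · exact hφ0 hx
      · exact (hφ.pd 0).eq_zero hx
    ext y
    rw [← sum_single_smul y, map_sum]
    simpa [pd] using Or.inr h1
  have hconst := is_const_of_fderiv_eq_zero (𝕜 := ℝ) (hφ.1.differentiable (by simp)) hfd 0
    (EuclideanSpace.single 0 1)
  have h0 : φ 0 = 1 := by
    simp [hφdef, cutoff, Real.smoothTransition.zero_of_nonpos]
  have h1 : φ (EuclideanSpace.single 0 1) = 0 :=
    hφ.eq_zero (by simp)
  rw [h0, h1] at hconst
  exact one_ne_zero hconst

theorem isExtrinsicHarmonic_equatorMap {k : ℕ} (hk : 1 ≤ k) (hkm : 2 * k + 1 ≤ m) (ℓ : ℕ) :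
    IsExtrinsicHarmonic (Metric.ball 0 1) k (equatorMap m (ℓ + 1)) :=
  have hm : 2 ≤ m := by lia
  isExtrinsicHarmonic_of_iterate_lap (by lia) (isHomog_equatorMap ℓ)
    (exists_iterate_lap_eq (isHomog_equatorMap ℓ) (lap_norm_zpow_smul_equatorMap hm ℓ))
    (norm_equatorMap hm ℓ)

end EquatorMap

end ExtrinsicHarmonic

theorem mainTheorem2 (k ℓ m : ℕ) (hk : 1 ≤ k) (hℓ : 1 ≤ ℓ) (hℓm : ℓ ≤ m) :
    (ExtrinsicHarmonic.MemWSphere (Metric.ball (0 : EuclideanSpace ℝ (Fin m)) 1) k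
        (ExtrinsicHarmonic.equatorMap m ℓ) ↔ 2 * k + 1 ≤ m) ∧
    (2 * k + 1 ≤ m →
      ExtrinsicHarmonic.IsExtrinsicHarmonic (Metric.ball (0 : EuclideanSpace ℝ (Fin m)) 1) k
        (ExtrinsicHarmonic.equatorMap m ℓ)) := by
  obtain ⟨ℓ, rfl⟩ := Nat.exists_eq_add_of_le' hℓ
  have hharm := fun h : 2 * k + 1 ≤ m => ExtrinsicHarmonic.isExtrinsicHarmonic_equatorMap hk h ℓ
  refine ⟨⟨fun h => ?_, fun h => (hharm h).1⟩, hharm⟩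
  by_contra hlt
  rcases Nat.lt_or_ge m 2 with hm | hm
  · obtain rfl : ℓ = 0 := by lia
    obtain rfl : m = 1 := by lia
    exact ExtrinsicHarmonic.not_memW_equatorMap_one hk h.1
  · exact ExtrinsicHarmonic.not_memW_equatorMap hm hk (by lia) ℓ h.1
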